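/- Let $d_1\ge 2$, $d_2\ge 0$, $d=d_1+d_2$. Let $\mathcal G<O(d_1)\oplus E(d_2)\subset E(d)$ be a discrete group of Euclidean isometries (all orbits are discrete) whose image $\mathcal S=\pi(\mathcal G)$ under the projection $\pi\colon A\oplus s\mapsto s$ to $E(d_2)$ is a $d_2$-dimensional space group, i.e. a discrete group containing $d_2$ translations with linearly independent translation vectors. Let $x_0\in\mathbb R^d$ be such that $g\mapsto g\cdot x_0$ is injective on $\mathcal G$. Write $\mathrm{rot}(g)\in O(d)$ for the linear component of $g$. Let $\mathcal T\subset\mathcal G$ be a set that $\pi$ maps bijectively onto the set of translations in $\mathcal S$, put $\mathcal T^N=\{t^N: t\in\mathcal T\}$, and let $M_0$ be the set of all $N\ge1$ for which $\mathcal T^N$ is a normal subgroup of $\mathcal G$ (it then has finite index); for $N\in M_0$ let $\mathcal C_N$ be a set of representatives of $\mathcal G/\mathcal T^N$. A function $u$ on $\mathcal G$ is $\mathcal T^N$-periodic if $u(gt)=u(g)$ for all $g\in\mathcal G$, $t\in\mathcal T^N$. Let $U_{\mathrm{per}}$ be the space of all $u\colon\mathcal G\to\mathbb R^d$ that are $\mathcal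 T^N$-periodic for some $N\in M_0$, with the uniform norm. Let $V\colon(\mathbb R^d)^{\mathcal G\setminus\{\mathrm{id}\}}\to\mathbb R$ be an interaction potential with $V(Ay)=V(y)$ for all $A\in O(d)$ and all $y$, such that for every $y$ the map $z\mapsto V(y+z)$ is twice continuously Fréchet differentiable on the space of bounded functions $\mathcal G\setminus\{\mathrm{id}\}\to\mathbb R^d$ with the uniform norm, and with finite interaction range: there is a finite set $\mathcal R_V\subset\mathcal G\setminus\{\mathrm{id}\}$ with $V(y)=V(\chi_{\mathcal R_V}y)$ for all $y$. The configurational energy $E\colon U_{\mathrm{per}}\to\mathbb R$ is $$E(w)=\frac1{|\mathcal C_N|}\sum_{g\in\mathcal C_N}V\Big(\big((gh)\cdot w(gh)-g\cdot w(g)\big)_{h\in\mathcal G\setminus\{\mathrm{id}\}}\Big)\qquad\text{if } w \text{ is } \mathcal T^N\text{-periodic},\ N\in M_0 .$$ The constant function $x_0\in U_{\mathrm{per}}$ corresponds to the identity deformation; $E'(x_0)$ and $E''(x_0)$ denote the first and second Fréchet derivatives of $E$ there. For a finite set $\mathcal R\subset\mathcal G$ let $U_{\mathrm{iso},0,0}(\mathcal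 R)$ be the space of all $v\colon\mathcal R\to\mathbb R^d$ for which there are $a\in\mathbb R^d$ and a skew-symmetric matrix of the form $S=S_1\oplus 0_{d_2,d_2}$, $S_1\in\mathbb R^{d_1\times d_1}$, with $\mathrm{rot}(g)v(g)=a+S(g\cdot x_0-x_0)$ for all $g\in\mathcal R$, let $\pi_{\mathcal R}$ be the orthogonal projection of $(\mathbb R^d)^{\mathcal R}$ (with its Euclidean norm) with kernel $U_{\mathrm{iso},0,0}(\mathcal R)$, and set $$\|u\|_{\mathcal R,0,0}=\Big(\frac1{|\mathcal C_N|}\sum_{g\in\mathcal C_N}\big\|\pi_{\mathcal R}\big(u(g\,\cdot)|_{\mathcal R}\big)\big\|^2\Big)^{1/2}\qquad\text{if } u\in U_{\mathrm{per}} \text{ is } \mathcal T^N\text{-periodic},\ N\in M_0 .$$ Assume that $\mathcal R$ is finite and that $\mathcal R'\mathcal R''\subset\mathcal R$ for some sets $\mathcal R',\mathcal R''\subset\mathcal G$ such that $\mathrm{id}\in\mathcal R'$, $\mathcal R'$ generates $\mathcal G$, $\mathcal R''$ is finite, $\mathrm{id}\in\mathcal R''$, and $\mathcal R''\cdot x_0$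 has the same affine hull as $\mathcal G\cdot x_0$. Theorem. The function $E$ is twice continuously Fréchet differentiable. If $E'(x_0)=0$ and $E''(x_0)$ is positive semidefinite, i.e. $E''(x_0)(u,u)\ge0$ for all $u\in U_{\mathrm{per}}$, then $E''(x_0)$ is bounded with respect to $\|\cdot\|_{\mathcal R,0,0}$: there is a constant $C>0$ such that $$|E''(x_0)(u,v)|\le C\,\|u\|_{\mathcal R,0,0}\,\|v\|_{\mathcal R,0,0}\qquad\text{for all } u,v\in U_{\mathrm{per}} .$$ -/

import Mathlib

open scoped ENNReal Pointwise RealInnerProductSpace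

noncomputable section

/-- The space `ℝ^d = ℝ^{d₁} × ℝ^{d₂}`, `d = d₁ + d₂`, with its Euclidean norm. -/
abbrev Space (d₁ d₂ : ℕ) : Type :=
  WithLp 2 (EuclideanSpace ℝ (Fin d₁) × EuclideanSpace ℝ (Fin d₂))

/-- The orthogonal group `O(n)`. -/
abbrev Orth (n : ℕ) : Type := EuclideanSpace ℝ (Fin n) ≃ₗᵢ[ℝ] EuclideanSpace ℝ (Fin n)

/-- The Euclidean group `E(n)` of all isometries of `ℝ^n`. -/
abbrev Euc (n : ℕ) : Type := EuclideanSpace ℝ (Fin n) ≃ᵃⁱ[ℝ] EuclideanSpace ℝ (Fin n)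

/-- The linear isometry `A ⊕ B` of `ℝ^{d₁} × ℝ^{d₂}`. -/
def linOplus {d₁ d₂ : ℕ} (A : Orth d₁) (B : Orth d₂) : Space d₁ d₂ ≃ₗᵢ[ℝ] Space d₁ d₂ where
  toFun x := WithLp.toLp 2 (A x.fst, B x.snd)
  invFun x := WithLp.toLp 2 (A.symm x.fst, B.symm x.snd)
  map_add' x y := by simp [← WithLp.toLp_add]
  map_smul' c x := by simp [← WithLp.toLp_smul]
  left_inv x := by simp; rfl
  right_inv x := by simp; rfl
  norm_map' x := by
    change ‖WithLp.toLp 2 (A x.fst, B x.snd)‖ = ‖x‖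
    simp [WithLp.prod_norm_eq_of_L2]

/-- The embedding `O(d₁) × E(d₂) → E(d₁ + d₂)`, `(A, s) ↦ A ⊕ s`, where
`(A ⊕ s) (x₁, x₂) = (A x₁, s x₂)`. -/
def oplus (d₁ d₂ : ℕ) : Orth d₁ × Euc d₂ →* (Space d₁ d₂ ≃ᵃⁱ[ℝ] Space d₁ d₂) where
  toFun g := AffineIsometryEquiv.mk' (fun x => WithLp.toLp 2 (g.1 x.fst, g.2 x.snd))
    (linOplus g.1 g.2.linearIsometryEquiv) 0 (fun x => by
      have h := g.2.map_vadd 0 x.snd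
      simp only [vadd_eq_add, add_zero] at h
      change WithLp.toLp 2 (g.1 x.fst, g.2 x.snd) =
        WithLp.toLp 2 (g.1 (x - 0).fst, g.2.linearIsometryEquiv (x - 0).snd) +
          WithLp.toLp 2 (g.1 0, g.2 0)
      rw [← WithLp.toLp_add, sub_zero, Prod.mk_add_mk, h]
      simp)
  map_one' := by ext x; rfl
  map_mul' g h := by ext x; rfl

/-- A group of isometries is discrete if every orbit is a discrete set. -/
def IsDiscreteGroup {W : Type*} [NormedAddCommGroup W] [NormedSpace ℝ W]
    (H : Subgroup (W ≃ᵃⁱ[ℝ] W)) : Prop :=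
  ∀ x : W, DiscreteTopology {y : W | ∃ g ∈ H, g x = y}

/-- The translation by `b`. -/
abbrev translation {n : ℕ} (b : EuclideanSpace ℝ (Fin n)) : Euc n :=
  AffineIsometryEquiv.constVAdd ℝ (EuclideanSpace ℝ (Fin n)) b

/-- An `n`-dimensional space group: a discrete group of isometries of `ℝ^n` containing `n`
translations with linearly independent translation vectors. -/
def IsSpaceGroup {n : ℕ} (S : Subgroup (Euc n)) : Prop :=
  IsDiscreteGroup S ∧
    ∃ b : Fin n → EuclideanSpace ℝ (Fin n),
      LinearIndependent ℝ b ∧ ∀ i, translation (b i) ∈ S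

/-- The set of translations contained in a group `S` of isometries. -/
def translationSet {n : ℕ} (S : Subgroup (Euc n)) : Set (Euc n) :=
  {s | s ∈ S ∧ ∃ b, s = translation b}

/-- The set `T^N = {t^N : t ∈ T}`. -/
def powSet {G : Type*} [Group G] (T : Set G) (N : ℕ) : Set G := (fun t => t ^ N) '' T

/-- The set `M₀` of all `N ≥ 1` such that `T^N` is a normal subgroup. (`T^N` is a subgroup
if and only if it coincides with the subgroup generated by it.) -/
def normalExponents {G : Type*} [Group G] (T : Set G) : Set ℕ :=
  {N | 0 < N ∧ (Subgroup.closure (powSet T N) : Set G) = powSet T N ∧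
    (Subgroup.closure (powSet T N)).Normal}

/-- An objective structure, given by a discrete group `grp < O(d₁) ⊕ S`, where the image `S` of
`grp` in `E(d₂)` is a `d₂`-dimensional space group, a section `T ⊆ grp` of the translation group
of `S`, and a point `x₀` with trivial stabilizer. -/
structure ObjectiveStructure (d₁ d₂ : ℕ) where
  grp : Subgroup (Orth d₁ × Euc d₂)
  discrete : IsDiscreteGroup (grp.map (oplus d₁ d₂))
  spaceGroup : IsSpaceGroup (grp.map (MonoidHom.snd _ _))
  T : Set grp
  bijOn_T : Set.BijOn (fun g : grp => (g : Orth d₁ × Euc d₂).2) T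
    (translationSet (grp.map (MonoidHom.snd _ _)))
  x₀ : Space d₁ d₂
  injective : Function.Injective (fun g : grp => oplus d₁ d₂ g x₀)

/-- If `T` is a section of a commutative, conjugation invariant subgroup `A` for a homomorphism `π`
with finite kernel, then `T^N` is a normal subgroup for all multiples `N` of some `N₀ ≥ 1`. -/
theorem exists_normalExponents {G Q : Type*} [Group G] [Group Q] (π : G →* Q) [Finite π.ker]
    (A : Set Q) (hone : 1 ∈ A) (hmul : ∀ a ∈ A, ∀ b ∈ A, a * b ∈ A) (hinv : ∀ a ∈ A, a⁻¹ ∈ A)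
    (hcomm : ∀ a ∈ A, ∀ b ∈ A, a * b = b * a) (hconj : ∀ g, ∀ a ∈ A, π g * a * (π g)⁻¹ ∈ A)
    (T : Set G) (hT : Set.BijOn π T A) :
    ∃ N₀, 0 < N₀ ∧ ∀ k, 0 < k → N₀ * k ∈ normalExponents T := by
  classical
  obtain ⟨a, ha, hcent⟩ : ∃ a, 0 < a ∧ ∀ (x f : G), f ∈ π.ker → x ^ a * f = f * x ^ a := by
    refine ⟨Nat.card (MulAut π.ker), Nat.card_pos, fun x f hf => ?_⟩
    have h : (MulAut.conjNormal (x ^ Nat.card (MulAut π.ker)) : MulAut π.ker) = 1 := by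
      rw [map_pow, pow_card_eq_one']
    have h2 := congrArg (fun φ : MulAut π.ker => ((φ ⟨f, hf⟩ : π.ker) : G)) h
    simp only [MulAut.conjNormal_apply, MulAut.one_apply] at h2
    rw [mul_inv_eq_iff_eq_mul] at h2
    exact h2
  set e := Nat.card π.ker with he
  have hepos : 0 < e := Nat.card_pos
  have hfe : ∀ f ∈ π.ker, f ^ e = 1 := fun f hf => by
    have : (⟨f, hf⟩ : π.ker) ^ e = 1 := pow_card_eq_one'
    simpa using congrArg Subtype.val this
  -- elements with the same image have the same power of order `a * e * m`
  have key0 : ∀ x y : G, (∀ f ∈ π.ker, y * f = f * y) → π x = π y → x ^ e = y ^ e := by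
    intro x y hy h
    have hf : y⁻¹ * x ∈ π.ker := by simp [MonoidHom.mem_ker, h]
    have hc : Commute y (y⁻¹ * x) := hy _ hf
    have := hc.mul_pow e
    rw [hfe _ hf, mul_one, mul_inv_cancel_left] at this
    exact this
  have key : ∀ x y : G, π x = π y → x ^ (a * e) = y ^ (a * e) := by
    intro x y h
    rw [pow_mul, pow_mul]
    exact key0 _ _ (hcent y) (by rw [map_pow, map_pow, h])
  have cent : ∀ x y : G, π x ∈ A → π y ∈ A → Commute (x ^ (a * e)) y := by
    intro x y hx hy
    have h := key (y * x * y⁻¹) x (by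
      rw [map_mul, map_mul, map_inv, hcomm _ hy _ hx, mul_inv_cancel_right])
    rw [conj_pow, mul_inv_eq_iff_eq_mul] at h
    exact h.symm
  have hTm : ∀ t ∈ T, π t ∈ A := fun t ht => hT.mapsTo ht
  have hTs : ∀ b ∈ A, ∃ t ∈ T, π t = b := fun b hb => hT.surjOn hb
  refine ⟨a * e * e, by positivity, fun k hk => ?_⟩
  have pw : ∀ x y : G, π x = π y → x ^ (a * e * e * k) = y ^ (a * e * e * k) := by
    intro x y h
    rw [mul_assoc (a * e), pow_mul, pow_mul _ (a * e), key x y h]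
  have pmul : ∀ t s r : G, π t ∈ A → π s ∈ A → π r = π t * π s →
      r ^ (a * e * e * k) = t ^ (a * e * e * k) * s ^ (a * e * e * k) := by
    intro t s r ht hs h
    have hc : Commute (t ^ (a * e)) (s ^ (a * e)) := (cent t s ht hs).pow_right _
    have hp : π (r ^ (a * e)) = π (t ^ (a * e) * s ^ (a * e)) := by
      have hc' : Commute (π t) (π s) := hcomm _ ht _ hs
      simp only [map_pow, map_mul, h]
      exact hc'.mul_pow _
    have h2 : (r ^ (a * e)) ^ e = (t ^ (a * e) * s ^ (a * e)) ^ e := by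
      refine key0 _ _ (fun f hf => ?_) hp
      have h1 : ∀ x : G, Commute (x ^ (a * e)) f := fun x => by
        rw [mul_comm a e, pow_mul]; exact hcent _ f hf
      exact ((h1 t).mul_left (h1 s))
    rw [pow_mul, pow_mul _ (a * e) e, h2, ← pow_mul _ e k, hc.mul_pow, mul_assoc (a * e),
      pow_mul t (a * e), pow_mul s (a * e)]
  let H : Subgroup G :=
    { carrier := powSet T (a * e * e * k)
      one_mem' := by
        obtain ⟨t, ht, h⟩ := hTs 1 hone
        exact ⟨t, ht, by simpa using pw t 1 (by rw [h, map_one])⟩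
      mul_mem' := by
        rintro _ _ ⟨t, ht, rfl⟩ ⟨s, hs, rfl⟩
        obtain ⟨r, hr, h⟩ := hTs _ (hmul _ (hTm t ht) _ (hTm s hs))
        exact ⟨r, hr, pmul t s r (hTm t ht) (hTm s hs) h⟩
      inv_mem' := by
        rintro _ ⟨t, ht, rfl⟩
        obtain ⟨r, hr, h⟩ := hTs _ (hinv _ (hTm t ht))
        exact ⟨r, hr, by simpa using pw r t⁻¹ (by rw [h, map_inv])⟩ }
  have hH : Subgroup.closure (powSet T (a * e * e * k)) = H := Subgroup.closure_eq H
  refine ⟨by positivity, by rw [hH]; rfl, ?_⟩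
  rw [hH]
  refine ⟨?_⟩
  rintro _ ⟨t, ht, rfl⟩ g
  obtain ⟨r, hr, h⟩ := hTs _ (hconj g _ (hTm t ht))
  exact ⟨r, hr, by simpa [conj_pow] using pw r (g * t * g⁻¹) (by simpa using h)⟩

namespace ObjectiveStructure

variable {d₁ d₂ : ℕ} (X : ObjectiveStructure d₁ d₂)

/-- The action `g · x`. -/
def act (g : X.grp) : Space d₁ d₂ ≃ᵃⁱ[ℝ] Space d₁ d₂ := oplus d₁ d₂ g

/-- The linear component `rot(g)`. -/
def rot (g : X.grp) : Space d₁ d₂ ≃ₗᵢ[ℝ] Space d₁ d₂ := (X.act g).linearIsometryEquiv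

/-- The natural homomorphism from the group to the space group. -/
def proj : X.grp →* Euc d₂ := (MonoidHom.snd (Orth d₁) (Euc d₂)).comp X.grp.subtype

theorem finite_orbit_ker (x : EuclideanSpace ℝ (Fin d₁)) :
    {y | ∃ g : X.grp, X.proj g = 1 ∧ (g : Orth d₁ × Euc d₂).1 x = y}.Finite := by
  set p : Space d₁ d₂ := WithLp.toLp 2 (x, 0) with hp
  set O : Set (Space d₁ d₂) := {y | ∃ g ∈ X.grp.map (oplus d₁ d₂), g p = y} with hO
  have hd : DiscreteTopology O := X.discrete p
  have hpO : p ∈ O := ⟨1, one_mem _, rfl⟩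
  obtain ⟨ε, hε, hball⟩ : ∃ ε > 0, ∀ y ∈ O, dist y p < ε → y = p := by
    obtain ⟨ε, hε, h⟩ := Metric.isOpen_singleton_iff.1 (isOpen_discrete {(⟨p, hpO⟩ : O)})
    exact ⟨ε, hε, fun y hy hdist => congrArg Subtype.val (h ⟨y, hy⟩ hdist)⟩
  have hsep : O.Pairwise fun y z => ε ≤ dist y z := by
    rintro _ ⟨g, hg, rfl⟩ _ ⟨h, hh, rfl⟩ hne
    by_contra hlt
    push Not at hlt
    apply hne
    have h1 : (h⁻¹ * g) p = p := by
      refine hball _ ⟨h⁻¹ * g, mul_mem (inv_mem hh) hg, rfl⟩ ?_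
      have : dist (h ((h⁻¹ * g) p)) (h p) = dist ((h⁻¹ * g) p) p := h.dist_map _ _
      rw [← this]
      simpa [AffineIsometryEquiv.coe_mul] using hlt
    have h2 := congrArg h h1
    simpa [AffineIsometryEquiv.coe_mul] using h2
  have hcl : IsClosed O := Metric.isClosed_of_pairwise_le_dist hε hsep
  have hfin := Metric.finite_isBounded_inter_isClosed (K := Metric.closedBall (0 : Space d₁ d₂) ‖p‖)
    (s := O) ⟨hd⟩ Metric.isBounded_closedBall hcl
  refine (hfin.image (fun z => z.fst)).subset ?_
  rintro _ ⟨g, hg, rfl⟩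
  have hg2 : (g : Orth d₁ × Euc d₂).2 = 1 := hg
  refine ⟨oplus d₁ d₂ g p, ⟨?_, _, ⟨g, g.2, rfl⟩, rfl⟩, rfl⟩
  have : oplus d₁ d₂ g p = WithLp.toLp 2 ((g : Orth d₁ × Euc d₂).1 x, 0) := by
    change WithLp.toLp 2 ((g : Orth d₁ × Euc d₂).1 x, (g : Orth d₁ × Euc d₂).2 0) = _
    rw [hg2]; rfl
  rw [this]
  simp [hp]

instance finite_ker : Finite X.proj.ker := by
  let b := EuclideanSpace.basisFun (Fin d₁) ℝ
  have : ∀ i, Finite {y | ∃ g : X.grp, X.proj g = 1 ∧ (g : Orth d₁ × Euc d₂).1 (b i) = y} :=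
    fun i => X.finite_orbit_ker (b i)
  let F : X.proj.ker →
      ∀ i, {y | ∃ g : X.grp, X.proj g = 1 ∧ (g : Orth d₁ × Euc d₂).1 (b i) = y} :=
    fun g i => ⟨((g : X.grp) : Orth d₁ × Euc d₂).1 (b i), (g : X.grp), g.2, rfl⟩
  refine Finite.of_injective F fun g h hgh => ?_
  apply Subtype.ext
  apply Subtype.ext
  refine Prod.ext ?_ ?_
  · apply LinearIsometryEquiv.toLinearEquiv_injective
    refine b.toBasis.ext' fun i => ?_
    have := congrArg Subtype.val (congrFun hgh i)
    simpa using this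
  · exact (show X.proj g = 1 from g.2).trans (show X.proj h = 1 from h.2).symm

/-- There is some `N₀ ≥ 1` all of whose multiples belong to `M₀`. -/
theorem exists_mul_mem_normalExponents :
    ∃ N₀, 0 < N₀ ∧ ∀ k, 0 < k → N₀ * k ∈ normalExponents X.T := by
  have tmul : ∀ b c : EuclideanSpace ℝ (Fin d₂),
      translation b * translation c = translation (b + c) := fun b c => by
    ext x : 1; simp [AffineIsometryEquiv.coe_mul, add_assoc]
  have tone : translation (0 : EuclideanSpace ℝ (Fin d₂)) = 1 := by
    ext x : 1; simp
  refine exists_normalExponents X.proj _ ?_ ?_ ?_ ?_ ?_ X.T X.bijOn_T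
  · exact ⟨one_mem _, 0, tone.symm⟩
  · rintro _ ⟨hs, b, rfl⟩ _ ⟨hs', c, rfl⟩
    exact ⟨mul_mem hs hs', b + c, tmul b c⟩
  · rintro _ ⟨hs, b, rfl⟩
    refine ⟨inv_mem hs, -b, ?_⟩
    rw [inv_eq_iff_mul_eq_one, tmul, add_neg_cancel, tone]
  · rintro _ ⟨hs, b, rfl⟩ _ ⟨hs', c, rfl⟩
    rw [tmul, tmul, add_comm]
  · rintro g _ ⟨hs, b, rfl⟩
    have hg : X.proj g ∈ X.grp.map (MonoidHom.snd (Orth d₁) (Euc d₂)) := ⟨g, g.2, rfl⟩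
    refine ⟨mul_mem (mul_mem hg hs) (inv_mem hg), (X.proj g).linearIsometryEquiv b, ?_⟩
    rw [mul_inv_eq_iff_eq_mul]
    ext x : 1
    have := (X.proj g).map_vadd x b
    simpa [AffineIsometryEquiv.coe_mul] using this

/-- `u` is `T^N`-periodic. -/
def IsPeriodicWith {S : Type*} (N : ℕ) (u : X.grp → S) : Prop :=
  ∀ g, ∀ t ∈ X.T, u (g * t ^ N) = u g

/-- `u` is periodic, i.e. `T^N`-periodic for some `N ∈ M₀`. -/
def IsPeriodic {S : Type*} (u : X.grp → S) : Prop :=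
  ∃ N ∈ normalExponents X.T, X.IsPeriodicWith N u

variable {X} in
theorem IsPeriodicWith.mul {S : Type*} {N : ℕ} {u : X.grp → S} (h : X.IsPeriodicWith N u) (k : ℕ) :
    X.IsPeriodicWith (N * k) u := by
  intro g t ht
  rw [pow_mul]
  induction k with
  | zero => simp
  | succ k ih => rw [pow_succ, ← mul_assoc, h _ t ht, ih]

/-- The space `U_per` of periodic functions `u : grp → ℝ^d` with the uniform norm, as a subspace of
the space of bounded functions. (Periodic functions take finitely many values, since `T^N` has
finite index.) -/
def Uper : Submodule ℝ (lp (fun _ : X.grp => Space d₁ d₂) ∞) where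
  carrier := {u | X.IsPeriodic (u : X.grp → Space d₁ d₂)}
  zero_mem' := by
    obtain ⟨N₀, h₀, h⟩ := X.exists_mul_mem_normalExponents
    exact ⟨_, h 1 one_pos, fun _ _ _ => rfl⟩
  add_mem' := by
    rintro u v ⟨N, hN, hu⟩ ⟨M, hM, hv⟩
    obtain ⟨N₀, h₀, h⟩ := X.exists_mul_mem_normalExponents
    refine ⟨N₀ * (N * M), h _ (Nat.mul_pos hN.1 hM.1), fun g t ht => ?_⟩
    have h1 := hu.mul (N₀ * M) g t ht
    have h2 := hv.mul (N₀ * N) g t ht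
    rw [show N * (N₀ * M) = N₀ * (N * M) by ring] at h1
    rw [show M * (N₀ * N) = N₀ * (N * M) by ring] at h2
    simp only [lp.coeFn_add, Pi.add_apply, h1, h2]
  smul_mem' := by
    rintro c u ⟨N, hN, hu⟩
    exact ⟨N, hN, fun g t ht => by simp only [lp.coeFn_smul, Pi.smul_apply, hu g t ht]⟩

/-- The function `grp → ℝ^d` underlying an element of `U_per`. -/
def fn (u : X.Uper) : X.grp → Space d₁ d₂ :=
  (u : lp (fun _ : X.grp => Space d₁ d₂) ∞)

/-- The constant function with value `x₀`, which corresponds to the identity deformation. -/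
def refConfig : X.Uper :=
  ⟨⟨fun _ => X.x₀, memℓp_infty ⟨‖X.x₀‖, by rintro _ ⟨_, rfl⟩; exact le_rfl⟩⟩, by
    obtain ⟨N₀, h₀, h⟩ := X.exists_mul_mem_normalExponents
    exact ⟨_, h 1 one_pos, fun _ _ _ => rfl⟩⟩

/-- A number `N ∈ M₀` such that `u` is `T^N`-periodic. -/
def period (u : X.Uper) : ℕ := u.2.choose

/-- The average `|C_N|⁻¹ ∑_{g ∈ C_N} F g`, where `C_N` is a set of representatives of
`grp / T^N`. -/
def average (N : ℕ) (F : X.grp → ℝ) : ℝ :=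
  (Nat.card (X.grp ⧸ Subgroup.closure (powSet X.T N)) : ℝ)⁻¹ *
    ∑ᶠ c : X.grp ⧸ Subgroup.closure (powSet X.T N), F c.out

/-! ### The interaction potential and the energy -/

/-- The assumptions on an interaction potential `V` with finite interaction range: `V` is invariant
under `O(d)`, the function `z ↦ V (y + z)` on the space of bounded functions is twice continuously
Fréchet differentiable for every `y`, and `V y` depends only on the restriction of `y` to some finite
set. -/
structure IsInteractionPotential (V : ({g : X.grp // g ≠ 1} → Space d₁ d₂) → ℝ) : Prop where
  invariant : ∀ (A : Space d₁ d₂ ≃ₗᵢ[ℝ] Space d₁ d₂) (y : {g : X.grp // g ≠ 1} → Space d₁ d₂),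
    V (fun g => A (y g)) = V y
  contDiff : ∀ y : {g : X.grp // g ≠ 1} → Space d₁ d₂,
    ContDiff ℝ 2 fun z : lp (fun _ : {g : X.grp // g ≠ 1} => Space d₁ d₂) ∞ =>
      V (fun g => y g + z g)
  finite_range : ∃ RV : Set {g : X.grp // g ≠ 1}, RV.Finite ∧
    ∀ y : {g : X.grp // g ≠ 1} → Space d₁ d₂, V y = V (RV.indicator y)

/-- The configurational energy `E(w) = |C_N|⁻¹ ∑_{g ∈ C_N} V (((gh) · w(gh) - g · w(g))_{h ≠ id})`
for `T^N`-periodic `w`. -/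
def energy (V : ({g : X.grp // g ≠ 1} → Space d₁ d₂) → ℝ) (w : X.Uper) : ℝ :=
  X.average (X.period w) fun g =>
    V fun h => X.act (g * h) (X.fn w (g * h)) - X.act g (X.fn w g)

/-- The first derivative `E'(x₀)` at the identity deformation. -/
def energyDeriv (V : ({g : X.grp // g ≠ 1} → Space d₁ d₂) → ℝ) : X.Uper →L[ℝ] ℝ :=
  fderiv ℝ (X.energy V) X.refConfig

/-- The second derivative `E''(x₀)` at the identity deformation. -/
def energyHess (V : ({g : X.grp // g ≠ 1} → Space d₁ d₂) → ℝ) : X.Uper →L[ℝ] X.Uper →L[ℝ] ℝ :=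
  fderiv ℝ (fderiv ℝ (X.energy V)) X.refConfig

/-! ### The seminorm -/

/-- The space of functions `R → ℝ^d` with the Euclidean norm. -/
abbrev LocalFun (R : Finset X.grp) : Type := PiLp 2 fun _ : R => Space d₁ d₂

/-- The functions `u : R → ℝ^d` for which `rot(g) u(g)` is constant. -/
def Utrans (R : Finset X.grp) : Submodule ℝ (X.LocalFun R) where
  carrier := {u | ∃ a : Space d₁ d₂, ∀ g : R, X.rot g (u g) = a}
  zero_mem' := ⟨0, fun g => by simp⟩
  add_mem' := by
    rintro u v ⟨a, ha⟩ ⟨b, hb⟩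
    exact ⟨a + b, fun g => by simp [ha, hb]⟩
  smul_mem' := by
    rintro c u ⟨a, ha⟩
    exact ⟨c • a, fun g => by simp [ha]⟩

/-- The space `Skew_{0,0}(d)` of skew symmetric linear maps of the form `S₁ ⊕ 0`, i.e. of those
skew symmetric maps whose blocks `ℝ^{d₂} → ℝ^{d₁}` and `ℝ^{d₂} → ℝ^{d₂}` vanish. -/
def skewZeroZero (d₁ d₂ : ℕ) : Submodule ℝ (Space d₁ d₂ →ₗ[ℝ] Space d₁ d₂) where
  carrier := {S | (∀ x y, ⟪S x, y⟫ = -⟪x, S y⟫) ∧ ∀ y, S (WithLp.toLp 2 (0, y)) = 0}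
  zero_mem' := by simp
  add_mem' := by
    rintro S S' ⟨h1, h2⟩ ⟨h1', h2'⟩
    refine ⟨fun x y => ?_, fun y => by simp [h2, h2']⟩
    simp only [LinearMap.add_apply, inner_add_left, inner_add_right, h1, h1']
    ring
  smul_mem' := by
    rintro c S ⟨h1, h2⟩
    refine ⟨fun x y => ?_, fun y => by simp [h2]⟩
    simp only [LinearMap.smul_apply, real_inner_smul_left, real_inner_smul_right, h1]
    ring

/-- The functions `u : R → ℝ^d` with `rot(g) u(g) = S (g · x₀ - x₀)` for some
`S ∈ Skew_{0,0}(d)`. -/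
def UrotZeroZero (R : Finset X.grp) : Submodule ℝ (X.LocalFun R) where
  carrier := {u | ∃ S ∈ skewZeroZero d₁ d₂, ∀ g : R, X.rot g (u g) = S (X.act g X.x₀ - X.x₀)}
  zero_mem' := ⟨0, zero_mem _, fun g => by simp⟩
  add_mem' := by
    rintro u v ⟨S, hS, h⟩ ⟨S', hS', h'⟩
    exact ⟨S + S', add_mem hS hS', fun g => by
      rw [PiLp.add_apply, map_add, h, h', LinearMap.add_apply]⟩
  smul_mem' := by
    rintro c u ⟨S, hS, h⟩
    exact ⟨c • S, Submodule.smul_mem _ c hS, fun g => by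
      rw [PiLp.smul_apply, map_smul, h, LinearMap.smul_apply]⟩

/-- `U_{iso,0,0}(R) = U_trans(R) + U_{rot,0,0}(R)`. -/
def UisoZeroZero (R : Finset X.grp) : Submodule ℝ (X.LocalFun R) :=
  X.Utrans R ⊔ X.UrotZeroZero R

/-- The seminorm `‖u‖_{R,0,0} = (|C_N|⁻¹ ∑_{g ∈ C_N} ‖π (u(g ·)|_R)‖²)^{1/2}` for `T^N`-periodic
`u`, where `π` is the orthogonal projection with kernel `U_{iso,0,0}(R)`. -/
def seminormZeroZero (R : Finset X.grp) (u : X.Uper) : ℝ :=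
  √(X.average (X.period u) fun g =>
    ‖(Submodule.orthogonal (X.UisoZeroZero R)).starProjection (WithLp.toLp 2 fun h : R => X.fn u (g * h))‖ ^ 2)

/-- `R` is finite, `id ∈ R`, and `R · x₀` and `grp · x₀` have the same affine hull. -/
def HasPropertyOne (R : Set X.grp) : Prop :=
  R.Finite ∧ 1 ∈ R ∧
    affineSpan ℝ ((fun g => X.act g X.x₀) '' R) =
      affineSpan ℝ (Set.range fun g => X.act g X.x₀)

/-- `R` is finite and there are `R'`, `R''` with `id ∈ R'`, `R'` generates `grp`, `R''` has
Property 1 and `R' R'' ⊆ R`. -/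
def HasPropertyTwo (R : Set X.grp) : Prop :=
  R.Finite ∧ ∃ R' R'' : Set X.grp, 1 ∈ R' ∧ Subgroup.closure R' = ⊤ ∧ X.HasPropertyOne R'' ∧
    R' * R'' ⊆ R

end ObjectiveStructure

end

/-! Finite range and `O(d)`-invariance of `V` turn the energy into the mean over the group of a C²
local density `Ψ` evaluated at the twisted differences `Dw(g) = (rot(h) w(gh) - w(g))_h` plus a
constant. Superposition with `Ψ` is C² on bounded functions and the mean is a bounded functional.
Hence `E` is C², and `E''(x₀)(u,v)` is the mean of `Q(Du, Dv)` with `Q = Ψ''(y₀)`, while `E'(x₀)(v)`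
is the mean of `f(Dv)` with `f = Ψ'(y₀)` (`exists_energy_expansion`).

A pointwise estimate of `Q(Du, Du)` is not enough: the seminorm ignores infinitesimal isometries,
whose differences have the form `S y₀` and need not be annihilated by `Q`. Differentiating the
rotation invariance gives `Q(S y₀, z) = -f(S z)`. At a critical point these terms cancel after
summation, so infinitesimal isometries lie in the kernel of the summed form, tested against finitely
supported fields (`sum_twistedDiff_isoField_eq_zero`). Periodizing along a sparse lattice carries
criticality and positivity over from periodic to finitely supported fields (`exists_periodization`).

On each translate `gR` the function `u` is within its local defect `n(g)` of some infinitesimal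
isometry. Neighbouring approximations overlap on a set large enough to determine them. Thus `u = r +
∑ pᵢ eᵢ` with fixed bounded infinitesimal isometries `eᵢ`, where `r` and the increments of `pᵢ` are
bounded by sums of translates of `n` (`exists_slow_coefficients`). For `e` in the kernel, the energy
of a finitely supported product `q e` is quadratic in the increments of `q`; positivity and the
parallelogram identity bound the energy of a sum by those of its summands (`exists_sumEnergy_le`).
Cutting off to a finite set costs a boundary term, which is negligible on Følner sets
(`cosetAverage_le_of_sum_le`). This gives `E''(x₀)(u,u) ≤ C ‖u‖²`, and the Cauchy–Schwarz inequality
for the semidefinite form finishes the proof. -/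

/-! ### Averages over cosets -/

section CosetAverage

variable {G : Type*} [Group G]

/-- The function `f` is invariant under right multiplication by elements of `H`. -/
def RightInvariant {S : Type*} (H : Subgroup G) (f : G → S) : Prop :=
  ∀ g, ∀ t ∈ H, f (g * t) = f g

/-- The average of `f` over a set of representatives of `G ⧸ H`. -/
noncomputable def cosetAverage (H : Subgroup G) (f : G → ℝ) : ℝ :=
  (Nat.card (G ⧸ H) : ℝ)⁻¹ * ∑ᶠ c : G ⧸ H, f c.out

theorem RightInvariant.shift {S : Type*} {H : Subgroup G} [hH : H.Normal] {f : G → S}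
    (hf : RightInvariant H f) (k : G) : RightInvariant H fun g => f (g * k) := by
  intro g t ht
  have := hf (g * k) (k⁻¹ * t * k) (by simpa using hH.conj_mem t ht k⁻¹)
  change f (g * t * k) = f (g * k)
  rw [← this]
  congr 1
  group

theorem RightInvariant.out_eq {S : Type*} {H : Subgroup G} {f : G → S} (hf : RightInvariant H f)
    (g : G) : f (QuotientGroup.mk g : G ⧸ H).out = f g := by
  obtain ⟨t, ht⟩ := QuotientGroup.mk_out_eq_mul H g
  rw [ht, hf _ _ t.2]

theorem cosetAverage_eq_sum (H : Subgroup G) [Fintype (G ⧸ H)] (f : G → ℝ) :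
    cosetAverage H f = (Fintype.card (G ⧸ H) : ℝ)⁻¹ * ∑ c : G ⧸ H, f c.out := by
  rw [cosetAverage, finsum_eq_sum_of_fintype, Nat.card_eq_fintype_card]

/-- Each coset of `H` splits into equally many cosets of `K`, on all of which `f` has the same
value. This makes averages independent of the chosen period. -/
theorem cosetAverage_of_le {H K : Subgroup G} [Finite (G ⧸ H)] [Finite (G ⧸ K)] (hKH : K ≤ H)
    {f : G → ℝ} (hf : RightInvariant H f) : cosetAverage K f = cosetAverage H f := by
  classical
  have := Fintype.ofFinite (G ⧸ H)
  have := Fintype.ofFinite (G ⧸ K)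
  let e := Subgroup.quotientEquivProdOfLE hKH
  have : Finite ((G ⧸ H) × H ⧸ K.subgroupOf H) := Finite.of_equiv _ e
  have hne : Nonempty (G ⧸ H) := ⟨((1 : G) : G ⧸ H)⟩
  have : Finite (H ⧸ K.subgroupOf H) := Finite.prod_right (G ⧸ H)
  have := Fintype.ofFinite (H ⧸ K.subgroupOf H)
  have hne' : Nonempty (H ⧸ K.subgroupOf H) := ⟨((1 : H) : H ⧸ K.subgroupOf H)⟩
  rw [cosetAverage_eq_sum, cosetAverage_eq_sum, Fintype.card_congr e, Fintype.card_prod]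
  have h1 : ∑ c : G ⧸ K, f c.out = ∑ p : (G ⧸ H) × H ⧸ K.subgroupOf H, f p.1.out := by
    refine Fintype.sum_equiv e _ _ fun c => ?_
    have : (e c).1 = (QuotientGroup.mk c.out : G ⧸ H) := by
      conv_lhs => rw [← QuotientGroup.out_eq' c]
      rfl
    rw [this, hf.out_eq]
  rw [h1, Fintype.sum_prod_type]
  simp only [Finset.sum_const, Finset.card_univ, nsmul_eq_mul, ← Finset.mul_sum]
  have : (Fintype.card (H ⧸ K.subgroupOf H) : ℝ) ≠ 0 := by exact_mod_cast Fintype.card_ne_zero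
  have : (Fintype.card (G ⧸ H) : ℝ) ≠ 0 := by exact_mod_cast Fintype.card_ne_zero
  push_cast
  field_simp

/-- Since `H` is normal, right multiplication by `k` permutes the cosets. -/
theorem cosetAverage_shift {H : Subgroup G} [H.Normal] [Finite (G ⧸ H)] {f : G → ℝ}
    (hf : RightInvariant H f) (k : G) :
    cosetAverage H (fun g => f (g * k)) = cosetAverage H f := by
  have := Fintype.ofFinite (G ⧸ H)
  rw [cosetAverage_eq_sum, cosetAverage_eq_sum]
  congr 1
  refine Fintype.sum_equiv (Equiv.mulRight (QuotientGroup.mk k : G ⧸ H)) _ _ fun c => ?_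
  have : c * (QuotientGroup.mk k : G ⧸ H) = QuotientGroup.mk (c.out * k) := by
    rw [QuotientGroup.mk_mul, QuotientGroup.out_eq']
  change f (c.out * k) = f (c * (QuotientGroup.mk k : G ⧸ H)).out
  rw [this, hf.out_eq]

theorem cosetAverage_add (H : Subgroup G) [Finite (G ⧸ H)] (f f' : G → ℝ) :
    cosetAverage H (fun g => f g + f' g) = cosetAverage H f + cosetAverage H f' := by
  have := Fintype.ofFinite (G ⧸ H)
  simp only [cosetAverage_eq_sum, Finset.sum_add_distrib, mul_add]

theorem cosetAverage_mul_left (H : Subgroup G) [Finite (G ⧸ H)] (c : ℝ) (f : G → ℝ) :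
    cosetAverage H (fun g => c * f g) = c * cosetAverage H f := by
  have := Fintype.ofFinite (G ⧸ H)
  simp only [cosetAverage_eq_sum, ← Finset.mul_sum]
  ring

theorem cosetAverage_sum {ι : Type*} (s : Finset ι) (H : Subgroup G) [Finite (G ⧸ H)]
    (f : ι → G → ℝ) :
    cosetAverage H (fun g => ∑ i ∈ s, f i g) = ∑ i ∈ s, cosetAverage H (f i) := by
  have := Fintype.ofFinite (G ⧸ H)
  simp only [cosetAverage_eq_sum, ← Finset.mul_sum]
  rw [Finset.sum_comm]

theorem abs_cosetAverage_le (H : Subgroup G) [Finite (G ⧸ H)] {f : G → ℝ} {M : ℝ}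
    (hf : ∀ g, |f g| ≤ M) : |cosetAverage H f| ≤ M := by
  have := Fintype.ofFinite (G ⧸ H)
  have hne : Nonempty (G ⧸ H) := ⟨((1 : G) : G ⧸ H)⟩
  have h0 : (0 : ℝ) < Fintype.card (G ⧸ H) := by exact_mod_cast Fintype.card_pos
  rw [cosetAverage_eq_sum, abs_mul, abs_inv, abs_of_pos h0, inv_mul_le_iff₀ h0]
  refine (Finset.abs_sum_le_sum_abs _ _).trans ((Finset.sum_le_sum fun c _ => hf _).trans ?_)
  simp

theorem cosetAverage_mono (H : Subgroup G) [Finite (G ⧸ H)] {f f' : G → ℝ}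
    (h : ∀ g, f g ≤ f' g) : cosetAverage H f ≤ cosetAverage H f' := by
  have := Fintype.ofFinite (G ⧸ H)
  rw [cosetAverage_eq_sum, cosetAverage_eq_sum]
  exact mul_le_mul_of_nonneg_left (Finset.sum_le_sum fun c _ => h _) (by positivity)

/-- The average of the square of a sum of translates. -/
theorem cosetAverage_sq_sum_shift_le (H : Subgroup G) [H.Normal]
    [Finite (G ⧸ H)] {n : G → ℝ} (hn : RightInvariant H n) (B : ℝ) (E : Finset G) :
    cosetAverage H (fun g => (B * ∑ k ∈ E, n (g * k)) ^ 2) ≤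
      B ^ 2 * (E.card : ℝ) ^ 2 * cosetAverage H fun g => n g ^ 2 := by
  have h1 : ∀ g, (B * ∑ k ∈ E, n (g * k)) ^ 2 ≤
      (B ^ 2 * E.card) * ∑ k ∈ E, n (g * k) ^ 2 := fun g => by
    rw [mul_pow, mul_assoc]
    exact mul_le_mul_of_nonneg_left sq_sum_le_card_mul_sum_sq (sq_nonneg B)
  refine (cosetAverage_mono H h1).trans (le_of_eq ?_)
  rw [cosetAverage_mul_left, cosetAverage_sum]
  have h2 : RightInvariant H fun g => n g ^ 2 := fun g t ht => by simp only [hn g t ht]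
  rw [Finset.sum_congr rfl fun k _ => cosetAverage_shift h2 k, Finset.sum_const, nsmul_eq_mul]
  ring

/-- The `H`-periodic function which has the values of `w` on the finite set `K`. -/
noncomputable def periodize {W : Type*} [AddCommMonoid W] (H : Subgroup G) (K : Finset G)
    (w : G → W) (g : G) : W :=
  open Classical in ∑ k ∈ K, if g⁻¹ * k ∈ H then w k else 0

theorem rightInvariant_periodize {W : Type*} [AddCommMonoid W] (H : Subgroup G) (K : Finset G)
    (w : G → W) : RightInvariant H (periodize H K w) := by
  intro g t ht
  refine Finset.sum_congr rfl fun k _ => ?_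
  rw [mul_inv_rev, mul_assoc, Subgroup.mul_mem_cancel_left _ (inv_mem ht)]

/-- If `H` is sufficiently sparse, the average of a local function of the `H`-periodization of a
finitely supported function is the sum of the local function of the original function. -/
theorem cosetAverage_periodize {W : Type*} [AddCommMonoid W] {H : Subgroup G} [H.Normal]
    [Finite (G ⧸ H)] (K K₂ E : Finset G) (w : G → W) (hw : ∀ g, g ∉ K → w g = 0)
    (hK₂ : ∀ g, ∀ h ∈ E, g * h ∈ K → g ∈ K₂)
    (h1 : ∀ a ∈ K₂, ∀ b ∈ K₂, a⁻¹ * b ∈ H → a = b)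
    (h2 : ∀ a ∈ K₂, ∀ h ∈ E, ∀ k ∈ K, (a * h)⁻¹ * k ∈ H → a * h = k)
    (Φ : (G → W) → ℝ) (hΦ : ∀ a b : G → W, (∀ h ∈ E, a h = b h) → Φ a = Φ b) (hΦ0 : Φ 0 = 0) :
    cosetAverage H (fun g => Φ fun h => periodize H K w (g * h)) =
      (Nat.card (G ⧸ H) : ℝ)⁻¹ * ∑ g ∈ K₂, Φ fun h => w (g * h) := by
  classical
  have := Fintype.ofFinite (G ⧸ H)
  rw [cosetAverage_eq_sum, Nat.card_eq_fintype_card]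
  congr 1
  set f : G → ℝ := fun g => Φ fun h => periodize H K w (g * h) with hf
  have hinv : RightInvariant H f := fun g t ht => by
    refine hΦ _ _ fun h _ => ?_
    exact (rightInvariant_periodize H K w).shift h g t ht
  have hinj : Set.InjOn (fun g : G => (QuotientGroup.mk g : G ⧸ H)) K₂ := fun a ha b hb hab =>
    h1 a ha b hb (QuotientGroup.eq.1 hab)
  -- If the periodization is nonzero at `c.out * h`, that point is congruent modulo `H` to some `k ∈
  -- K`. By normality `c.out` can be moved inside its coset so that multiplication by `h` gives
  -- exactly `k`, hence `c` meets `K₂`.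
  have hzero : ∀ c : G ⧸ H, c ∉ K₂.image (fun g : G => (QuotientGroup.mk g : G ⧸ H)) →
      f c.out = 0 := by
    intro c hc
    rw [← hΦ0]
    refine hΦ _ _ fun h hh => Finset.sum_eq_zero fun k hk => if_neg fun hmem => hc ?_
    have hm : c.out * (h * ((c.out * h)⁻¹ * k) * h⁻¹) ∈ K₂ := by
      refine hK₂ _ h hh ?_
      convert hk using 1
      group
    refine Finset.mem_image.2 ⟨_, hm, ?_⟩
    rw [QuotientGroup.mk_mul_of_mem _ (Subgroup.Normal.conj_mem inferInstance _ hmem h),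
      QuotientGroup.out_eq']
  rw [← Finset.sum_subset (Finset.subset_univ _) fun c _ hc => hzero c hc, Finset.sum_image hinj]
  refine Finset.sum_congr rfl fun a ha => ?_
  rw [hinv.out_eq]
  refine hΦ _ _ fun h hh => ?_
  -- By sparseness the point `a * h` sees only its own copy of `K`.
  have : periodize H K w (a * h) = ∑ k ∈ K, if a * h = k then w k else 0 := by
    refine Finset.sum_congr rfl fun k hk => ?_
    by_cases hak : a * h = k
    · rw [if_pos hak, if_pos]
      rw [hak, inv_mul_cancel]
      exact one_mem _
    · rw [if_neg hak, if_neg fun hm => hak (h2 a ha h hh k hk hm)]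
  rw [this, Finset.sum_ite_eq]
  split_ifs with hm
  · rfl
  · exact (hw _ hm).symm

end CosetAverage

/-! ### Følner sets -/

section Folner

open Filter in
/-- Finite sets in commutative groups have small boundary after being suitably enlarged. -/
theorem exists_folner_of_comm {A : Type*} [CommGroup A] [DecidableEq A] (E : Finset A) {ε : ℝ}
    (hε : 0 < ε) :
    ∃ K : Finset A, K.Nonempty ∧ ∀ e ∈ E, ((K.filter fun a => a * e ∉ K).card : ℝ) ≤ ε * K.card := by
  -- Images of the boxes of exponents `[0, n)^E`. Their cardinality grows at most polynomially, and
  -- one step in a direction of `E` leads from `K n` into `K (n + 1)`.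
  let K : ℕ → Finset A := fun n =>
    (Fintype.piFinset fun _ : E => Finset.range n).image fun x => ∏ e : E, (e : A) ^ x e
  have hcard : ∀ n, (K n).card ≤ n ^ E.card := fun n => by
    refine Finset.card_image_le.trans ?_
    simp
  have hne : ∀ n, (K (n + 1)).Nonempty := fun n =>
    (Fintype.piFinset_nonempty.2 fun _ => ⟨0, by simp⟩).image _
  have hsub : ∀ n, K n ⊆ K (n + 1) := fun n => by
    refine Finset.image_subset_image (Fintype.piFinset_subset _ _ fun _ => ?_)
    exact Finset.range_subset_range.2 n.le_succ
  have hmul : ∀ n, ∀ e ∈ E, ∀ a ∈ K n, a * e ∈ K (n + 1) := by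
    intro n e he a ha
    obtain ⟨x, hx, rfl⟩ := Finset.mem_image.1 ha
    refine Finset.mem_image.2 ⟨fun i => x i + if i = ⟨e, he⟩ then 1 else 0, ?_, ?_⟩
    · rw [Fintype.mem_piFinset] at hx ⊢
      intro i
      have := hx i
      simp only [Finset.mem_range] at this ⊢
      split_ifs <;> omega
    · simp only [pow_add, Finset.prod_mul_distrib]
      congr 1
      simp [pow_ite]
  -- Otherwise the cardinality would grow by a factor `1 + ε` at every step, against the polynomial
  -- bound. Indices start at 1 because `K 0` can be empty.
  obtain ⟨n, hn⟩ : ∃ n, ((K (n + 2)).card : ℝ) ≤ (1 + ε) * (K (n + 1)).card := by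
    by_contra! hcon
    have hgrow : ∀ n, (1 + ε) ^ n ≤ ((K (n + 1)).card : ℝ) := by
      intro n
      induction n with
      | zero =>
        have := (hne 0).card_pos
        simpa using this
      | succ n ih =>
        rw [pow_succ']
        exact (mul_le_mul_of_nonneg_left ih (by positivity)).trans (hcon n).le
    have hlim := tendsto_pow_const_div_const_pow_of_one_lt E.card (r := 1 + ε) (by linarith)
    -- The threshold `(1 + ε)⁻¹` absorbs the shift of the exponent from `n + 1` to `n`.
    have hev := ((tendsto_add_atTop_iff_nat 1).2 hlim).eventually
      (gt_mem_nhds (show (0 : ℝ) < (1 + ε)⁻¹ by positivity))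
    obtain ⟨n, hn⟩ := hev.exists
    have h1 := hgrow n
    have h2 : ((K (n + 1)).card : ℝ) ≤ ((n + 1 : ℕ) : ℝ) ^ E.card := by
      exact_mod_cast hcard (n + 1)
    rw [div_lt_iff₀ (by positivity), pow_succ', inv_mul_cancel_left₀ (by positivity)] at hn
    linarith
  refine ⟨K (n + 1), hne n, fun e he => ?_⟩
  have hle : ((K (n + 1)).filter fun a => a * e ∉ K (n + 1)).card ≤
      (K (n + 2) \ K (n + 1)).card := by
    refine Finset.card_le_card_of_injOn (fun a => a * e) (fun a ha => ?_)
      (fun a _ b _ h => mul_right_cancel h)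
    have ha' := Finset.mem_filter.1 ha
    exact Finset.mem_sdiff.2 ⟨hmul _ e he a ha'.1, ha'.2⟩
  have h3 := Finset.card_sdiff_add_card_eq_card (hsub (n + 1))
  have h4 : ((K (n + 2) \ K (n + 1)).card : ℝ) + (K (n + 1)).card = (K (n + 2)).card := by
    exact_mod_cast h3
  have h5 : (((K (n + 1)).filter fun a => a * e ∉ K (n + 1)).card : ℝ) ≤
    (K (n + 2) \ K (n + 1)).card := by exact_mod_cast hle
  linarith

/-- In a group with a commutative normal subgroup `H` of finite index, there are sets with small
boundary which contain each coset of `H` equally often. -/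
theorem exists_folner {G : Type*} [Group G] [DecidableEq G] (H : Subgroup G) [H.Normal]
    [Finite (G ⧸ H)] (hcomm : ∀ a ∈ H, ∀ b ∈ H, a * b = b * a) (E : Finset G) {ε : ℝ}
    (hε : 0 < ε) :
    ∃ F : Finset G, F.Nonempty ∧
      (∀ f : G → ℝ, RightInvariant H f → ∑ g ∈ F, f g = F.card * cosetAverage H f) ∧
      ∀ e ∈ E, ((F.filter fun g => g * e ∉ F).card : ℝ) ≤ ε * F.card := by
  classical
  have := Fintype.ofFinite (G ⧸ H)
  have hne : Nonempty (G ⧸ H) := ⟨((1 : G) : G ⧸ H)⟩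
  let _ : CommGroup H := { (inferInstance : Group H) with
    mul_comm := fun a b => Subtype.ext (hcomm a a.2 b b.2) }
  -- The cocycle of the chosen representatives: in the coordinates `H × G ⧸ H`, right multiplication
  -- by `e` acts as `(a, c) ↦ (a * t' c e, c * e)`. A Følner set `A ⊆ H` for all these cocycle
  -- values, times the full set of representatives, is therefore a Følner set in `G`.
  let t' : (G ⧸ H) → G → H := fun c e =>
    ⟨c.out * e * (c * (QuotientGroup.mk e : G ⧸ H)).out⁻¹, by
      rw [← QuotientGroup.eq_one_iff]
      simp⟩
  have ht' : ∀ c e, c.out * e = t' c e * (c * (QuotientGroup.mk e : G ⧸ H)).out := fun c e => by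
    simp [t']
  obtain ⟨A, hA, hAE⟩ := exists_folner_of_comm
    ((Finset.univ ×ˢ E).image fun p : (G ⧸ H) × G => t' p.1 p.2) hε
  let φ : H × (G ⧸ H) → G := fun p => p.1 * p.2.out
  have hmk : ∀ p, (QuotientGroup.mk (φ p) : G ⧸ H) = p.2 := fun p => by
    simp [φ]
  have hφ : Function.Injective φ := fun p q h => by
    have h2 : p.2 = q.2 := by rw [← hmk p, h, hmk]
    have h1 : (p.1 : G) * p.2.out = q.1 * q.2.out := h
    rw [h2] at h1
    exact Prod.ext (Subtype.ext (mul_right_cancel h1)) h2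
  have hmem : ∀ p, φ p ∈ (A ×ˢ (Finset.univ : Finset (G ⧸ H))).image φ ↔ p.1 ∈ A := fun p => by
    rw [hφ.mem_finset_image]
    simp
  have hcardF : ((A ×ˢ (Finset.univ : Finset (G ⧸ H))).image φ).card =
      A.card * Fintype.card (G ⧸ H) := by
    rw [Finset.card_image_of_injective _ hφ, Finset.card_product, Finset.card_univ]
  refine ⟨(A ×ˢ Finset.univ).image φ, (hA.product Finset.univ_nonempty).image _, ?_, ?_⟩
  · intro f hf
    rw [hcardF, Finset.sum_image hφ.injOn, Finset.sum_product, cosetAverage_eq_sum]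
    have h0 : (Fintype.card (G ⧸ H) : ℝ) ≠ 0 := by exact_mod_cast Fintype.card_ne_zero
    have : ∀ a : H, ∀ c : G ⧸ H, f (φ (a, c)) = f c.out := fun a c => by
      rw [← hf.out_eq, hmk]
    simp only [this, Finset.sum_const, nsmul_eq_mul]
    push_cast
    rw [mul_assoc, mul_inv_cancel_left₀ h0]
  · intro e he
    have hset : ((A ×ˢ (Finset.univ : Finset (G ⧸ H))).image φ).filter
        (fun g => g * e ∉ (A ×ˢ (Finset.univ : Finset (G ⧸ H))).image φ) =
        ((Finset.univ : Finset (G ⧸ H)).biUnion fun c =>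
          (A.filter fun a => a * t' c e ∉ A).image fun a => φ (a, c)) := by
      have hstep : ∀ a c, φ (a, c) * e = φ (a * t' c e, c * (QuotientGroup.mk e : G ⧸ H)) := by
        intro a c
        simp only [φ, Subgroup.coe_mul, mul_assoc, ht']
      ext g
      simp only [Finset.mem_filter, Finset.mem_biUnion, Finset.mem_univ, true_and]
      constructor
      · rintro ⟨hg, hge⟩
        obtain ⟨⟨a, c⟩, hac, rfl⟩ := Finset.mem_image.1 hg
        rw [hstep, hmem] at hge
        exact ⟨c, Finset.mem_image.2 ⟨a, Finset.mem_filter.2 ⟨(Finset.mem_product.1 hac).1, hge⟩,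
          rfl⟩⟩
      · rintro ⟨c, hc⟩
        obtain ⟨a, ha, rfl⟩ := Finset.mem_image.1 hc
        obtain ⟨ha1, ha2⟩ := Finset.mem_filter.1 ha
        rw [hstep, hmem, hmem]
        exact ⟨ha1, ha2⟩
    rw [hset, hcardF]
    have h1 : ∀ c : G ⧸ H, ((((A.filter fun a => a * t' c e ∉ A).image fun a => φ (a, c)).card : ℕ)
        : ℝ) ≤ ε * A.card := fun c => by
      refine le_trans ?_ (hAE (t' c e) (Finset.mem_image.2 ⟨(c, e), by simp [he], rfl⟩))
      exact_mod_cast Finset.card_image_le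
    calc _ ≤ ∑ c : G ⧸ H, ((((A.filter fun a => a * t' c e ∉ A).image fun a => φ (a, c)).card : ℕ)
          : ℝ) := by exact_mod_cast Finset.card_biUnion_le
      _ ≤ ∑ _c : G ⧸ H, ε * A.card := Finset.sum_le_sum fun c _ => h1 c
      _ = _ := by simp; ring

end Folner

/-! ### Superposition operators on spaces of bounded functions -/

section Superposition

set_option linter.unusedSectionVars false

variable {α Y Z : Type*} [NormedAddCommGroup Y] [NormedSpace ℝ Y] [NormedAddCommGroup Z]
  [NormedSpace ℝ Z]

theorem lp_norm_apply_le (f : lp (fun _ : α => Y) ∞) (a : α) : ‖f a‖ ≤ ‖f‖ :=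
  lp.norm_apply_le_norm ENNReal.top_ne_zero f a

/-- Construct an element of the space of bounded functions. -/
def boundedMk (f : α → Y) (M : ℝ) (hf : ∀ a, ‖f a‖ ≤ M) : lp (fun _ : α => Y) ∞ :=
  ⟨f, memℓp_infty ⟨M, by rintro _ ⟨a, rfl⟩; exact hf a⟩⟩

/-- Pointwise application of bounded functions with values in a space of linear maps. -/
noncomputable def pointwiseApply (α Y Z : Type*) [NormedAddCommGroup Y] [NormedSpace ℝ Y]
    [NormedAddCommGroup Z] [NormedSpace ℝ Z] :
    lp (fun _ : α => Y →L[ℝ] Z) ∞ →L[ℝ] lp (fun _ : α => Y) ∞ →L[ℝ] lp (fun _ : α => Z) ∞ :=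
  LinearMap.mkContinuous₂
    (LinearMap.mk₂ ℝ
      (fun A f => boundedMk (fun a => A a (f a)) (‖A‖ * ‖f‖) fun a =>
        ((A a).le_opNorm _).trans (mul_le_mul (lp_norm_apply_le A a) (lp_norm_apply_le f a)
          (norm_nonneg _) (norm_nonneg _)))
      (fun A B f => by ext a; simp [boundedMk]; rfl)
      (fun c A f => by ext a; simp [boundedMk])
      (fun A f g => by ext a; simp [boundedMk]; rfl)
      (fun c A f => by ext a; simp [boundedMk])) 1
    (fun A f => by
      rw [one_mul]
      refine lp.norm_le_of_forall_le (by positivity) fun a => ?_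
      exact ((A a).le_opNorm _).trans (mul_le_mul (lp_norm_apply_le A a) (lp_norm_apply_le f a)
        (norm_nonneg _) (norm_nonneg _)))

theorem pointwiseApply_apply (A : lp (fun _ : α => Y →L[ℝ] Z) ∞) (f : lp (fun _ : α => Y) ∞)
    (a : α) : pointwiseApply α Y Z A f a = A a (f a) := rfl

variable [ProperSpace Y]

/-- The superposition operator `f ↦ Ψ ∘ f`. -/
noncomputable def superpose (α : Type*) (Ψ : Y → Z) (hΨ : Continuous Ψ)
    (f : lp (fun _ : α => Y) ∞) : lp (fun _ : α => Z) ∞ :=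
  boundedMk (fun a => Ψ (f a))
    ((isCompact_closedBall (0 : Y) ‖f‖).exists_bound_of_continuousOn hΨ.continuousOn).choose
    fun a => ((isCompact_closedBall (0 : Y) ‖f‖).exists_bound_of_continuousOn
      hΨ.continuousOn).choose_spec _ (by simpa using lp_norm_apply_le f a)

theorem superpose_apply (Ψ : Y → Z) (hΨ : Continuous Ψ) (f : lp (fun _ : α => Y) ∞) (a : α) :
    superpose α Ψ hΨ f a = Ψ (f a) := rfl

/-- Closed balls of `Y` are compact, so `Ψ` is uniformly continuous on the ball of radius `r + 1`,
which contains `z` once `δ ≤ 1`. The values of a bounded function stay in one ball, so a single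
modulus serves all arguments. -/
theorem exists_modulus {Ψ : Y → Z} (hΨ : Continuous Ψ) (r : ℝ) {ε : ℝ} (hε : 0 < ε) :
    ∃ δ > 0, ∀ y, ‖y‖ ≤ r → ∀ z, ‖z - y‖ < δ → ‖Ψ z - Ψ y‖ ≤ ε := by
  have hu := (isCompact_closedBall (0 : Y) (r + 1)).uniformContinuousOn_of_continuous
    hΨ.continuousOn
  obtain ⟨δ, hδ, h⟩ := Metric.uniformContinuousOn_iff.1 hu ε hε
  refine ⟨min δ 1, lt_min hδ one_pos, fun y hy z hz => ?_⟩
  have hz' : ‖z‖ ≤ r + 1 := by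
    have h1 := norm_le_norm_add_norm_sub' z y
    have h2 := hz.le.trans (min_le_right _ _)
    linarith
  have := h z (by simpa using hz') y (by simp; linarith)
    (by rw [dist_eq_norm]; exact hz.trans_le (min_le_left _ _))
  rw [dist_eq_norm] at this
  exact this.le

theorem continuous_superpose (Ψ : Y → Z) (hΨ : Continuous Ψ) : Continuous (superpose α Ψ hΨ) := by
  rw [Metric.continuous_iff]
  intro f ε hε
  obtain ⟨δ, hδ, h⟩ := exists_modulus hΨ ‖f‖ (half_pos hε)
  refine ⟨δ, hδ, fun g hg => ?_⟩
  rw [dist_eq_norm] at hg ⊢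
  refine lt_of_le_of_lt ?_ (half_lt_self hε)
  refine lp.norm_le_of_forall_le (half_pos hε).le fun a => ?_
  exact h _ (lp_norm_apply_le f a) _ ((lp_norm_apply_le (g - f) a).trans_lt hg)

/-- The mean value inequality with the uniform modulus of `fderiv ℝ Ψ` makes the pointwise remainder
small uniformly in `a`. -/
theorem hasFDerivAt_superpose (Ψ : Y → Z) (hΨ : ContDiff ℝ 1 Ψ) (f : lp (fun _ : α => Y) ∞) :
    HasFDerivAt (superpose α Ψ hΨ.continuous)
      (pointwiseApply α Y Z
        (superpose α (fderiv ℝ Ψ) (hΨ.continuous_fderiv one_ne_zero) f)) f := by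
  rw [hasFDerivAt_iff_isLittleO_nhds_zero, Asymptotics.isLittleO_iff]
  intro ε hε
  obtain ⟨δ, hδ, h⟩ := exists_modulus (hΨ.continuous_fderiv one_ne_zero) ‖f‖ hε
  filter_upwards [Metric.ball_mem_nhds _ hδ] with v hv
  rw [mem_ball_zero_iff] at hv
  refine lp.norm_le_of_forall_le (by positivity) fun a => ?_
  have hva : ‖v a‖ < δ := (lp_norm_apply_le v a).trans_lt hv
  have hmv := (convex_ball (f a) δ).norm_image_sub_le_of_norm_hasFDerivWithin_le' (f := Ψ)
    (f' := fderiv ℝ Ψ) (φ := fderiv ℝ Ψ (f a)) (C := ε)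
    (fun x _ => (hΨ.differentiable one_ne_zero x).hasFDerivAt.hasFDerivWithinAt)
    (fun x hx => h _ (lp_norm_apply_le f a) _ (by simpa [dist_eq_norm] using hx))
    (Metric.mem_ball_self hδ) (y := f a + v a) (by simpa using hva)
  simp only [add_sub_cancel_left] at hmv
  exact hmv.trans (mul_le_mul_of_nonneg_left (lp_norm_apply_le v a) hε.le)

theorem contDiff_superpose_zero (Ψ : Y → Z) (hΨ : Continuous Ψ) :
    ContDiff ℝ 0 (superpose α Ψ hΨ) :=
  contDiff_zero.2 (continuous_superpose Ψ hΨ)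

/-- The derivative is the superposition operator of `fderiv ℝ Ψ` followed by a bounded linear map,
so regularity is gained one order at a time. -/
theorem contDiff_superpose_succ {n : ℕ} (Ψ : Y → Z) (hΨ : ContDiff ℝ 1 Ψ)
    (h : ContDiff ℝ n (superpose α (fderiv ℝ Ψ) (hΨ.continuous_fderiv one_ne_zero))) :
    ContDiff ℝ (n + 1) (superpose α Ψ hΨ.continuous) := by
  rw [contDiff_succ_iff_fderiv]
  refine ⟨fun f => (hasFDerivAt_superpose Ψ hΨ f).differentiableAt, by simp, ?_⟩
  have : fderiv ℝ (superpose α Ψ hΨ.continuous) = fun f => pointwiseApply α Y Z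
      (superpose α (fderiv ℝ Ψ) (hΨ.continuous_fderiv one_ne_zero) f) :=
    funext fun f => (hasFDerivAt_superpose Ψ hΨ f).fderiv
  rw [this]
  exact (pointwiseApply α Y Z).contDiff.comp h

theorem contDiff_superpose_two (Ψ : Y → Z) (hΨ : ContDiff ℝ 2 Ψ) :
    ContDiff ℝ 2 (superpose α Ψ hΨ.continuous) := by
  have h1 : ContDiff ℝ 1 (fderiv ℝ Ψ) := hΨ.fderiv_right (by norm_num)
  have h := contDiff_superpose_succ (α := α) (n := 0) (fderiv ℝ Ψ) h1 (contDiff_superpose_zero _ _)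
  exact contDiff_superpose_succ (α := α) (n := 1) Ψ (hΨ.of_le (by norm_num)) (by simpa using h)

/-- Derivatives of the composition of a linear functional, a superposition operator and an affine
map. -/
theorem superpose_functional_fderiv {U : Type*} [NormedAddCommGroup U] [NormedSpace ℝ U]
    (m : lp (fun _ : α => Z) ∞ →L[ℝ] ℝ) (D : U →L[ℝ] lp (fun _ : α => Y) ∞)
    (c : lp (fun _ : α => Y) ∞) (Ψ : Y → Z) (hΨ : ContDiff ℝ 1 Ψ) (w v : U) :
    fderiv ℝ (fun w => m (superpose α Ψ hΨ.continuous (D w + c))) w v =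
      m (pointwiseApply α Y Z
        (superpose α (fderiv ℝ Ψ) (hΨ.continuous_fderiv one_ne_zero) (D w + c)) (D v)) := by
  have h1 : HasFDerivAt (fun w => D w + c) D w := D.hasFDerivAt.add_const c
  have h2 := m.hasFDerivAt.comp w ((hasFDerivAt_superpose Ψ hΨ (D w + c)).comp w h1)
  have h3 := h2.fderiv
  simp only [Function.comp_def] at h3
  rw [h3]
  rfl

theorem superpose_functional_fderiv_two {U : Type*} [NormedAddCommGroup U] [NormedSpace ℝ U]
    (m : lp (fun _ : α => ℝ) ∞ →L[ℝ] ℝ) (D : U →L[ℝ] lp (fun _ : α => Y) ∞)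
    (c : lp (fun _ : α => Y) ∞) (Ψ : Y → ℝ) (hΨ : ContDiff ℝ 2 Ψ) :
    ContDiff ℝ 2 (fun w => m (superpose α Ψ hΨ.continuous (D w + c))) ∧
    ∀ w u v : U, fderiv ℝ (fderiv ℝ (fun w => m (superpose α Ψ hΨ.continuous (D w + c)))) w u v =
      m (pointwiseApply α Y ℝ
        (pointwiseApply α Y (Y →L[ℝ] ℝ) (superpose α (fderiv ℝ (fderiv ℝ Ψ))
          ((hΨ.fderiv_right (m := 1) (by norm_num)).continuous_fderiv one_ne_zero) (D w + c))
          (D u)) (D v)) := by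
  have hc : ContDiff ℝ 2 (fun w => m (superpose α Ψ hΨ.continuous (D w + c))) :=
    m.contDiff.comp ((contDiff_superpose_two Ψ hΨ).comp (D.contDiff.add contDiff_const))
  refine ⟨hc, fun w u v => ?_⟩
  have hd : ContDiff ℝ 1 (fderiv ℝ (fun w => m (superpose α Ψ hΨ.continuous (D w + c)))) :=
    hc.fderiv_right (by norm_num)
  have h1 := ((hd.differentiable one_ne_zero w).hasFDerivAt).clm_apply (hasFDerivAt_const v w)
  have h2 : (fun w' => fderiv ℝ (fun w => m (superpose α Ψ hΨ.continuous (D w + c))) w' v) =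
      fun w' => m (pointwiseApply α Y ℝ (superpose α (fderiv ℝ Ψ)
        ((hΨ.of_le (by norm_num) : ContDiff ℝ 1 Ψ).continuous_fderiv one_ne_zero) (D w' + c))
        (D v)) :=
    funext fun w' => superpose_functional_fderiv m D c Ψ (hΨ.of_le (by norm_num)) w' v
  rw [h2] at h1
  -- For fixed `v` the first derivative has the same shape again, with density `fderiv ℝ Ψ` and with
  -- `m` composed with evaluation on `D v`.
  have h3 := superpose_functional_fderiv (Z := Y →L[ℝ] ℝ)
    (m.comp ((pointwiseApply α Y ℝ).flip (D v))) D c (fderiv ℝ Ψ)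
    (hΨ.fderiv_right (by norm_num)) w u
  have h4 := congrArg (fun L => L u) h1.fderiv
  simp only [add_apply, ContinuousLinearMap.comp_apply,
    ContinuousLinearMap.flip_apply] at h3 h4
  rw [h3] at h4
  simpa using h4.symm

end Superposition

/-! ### The group of an objective structure -/

/-- The group acts by isometries, so the isolation radius of one orbit point serves all of them. The
orbit is uniformly separated, hence closed, and meets each ball in a finite set. -/
theorem IsDiscreteGroup.finite_orbit_inter_closedBall {W : Type*} [NormedAddCommGroup W]
    [NormedSpace ℝ W] [ProperSpace W] {H : Subgroup (W ≃ᵃⁱ[ℝ] W)} (hH : IsDiscreteGroup H)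
    (p : W) (r : ℝ) :
    ({y : W | ∃ g ∈ H, g p = y} ∩ Metric.closedBall 0 r).Finite := by
  set O : Set W := {y | ∃ g ∈ H, g p = y} with hO
  have hd : DiscreteTopology O := hH p
  have hpO : p ∈ O := ⟨1, one_mem _, rfl⟩
  obtain ⟨ε, hε, hball⟩ : ∃ ε > 0, ∀ y ∈ O, dist y p < ε → y = p := by
    obtain ⟨ε, hε, h⟩ := Metric.isOpen_singleton_iff.1 (isOpen_discrete {(⟨p, hpO⟩ : O)})
    exact ⟨ε, hε, fun y hy hdist => congrArg Subtype.val (h ⟨y, hy⟩ hdist)⟩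
  have hsep : O.Pairwise fun y z => ε ≤ dist y z := by
    rintro _ ⟨g, hg, rfl⟩ _ ⟨h, hh, rfl⟩ hne
    by_contra hlt
    push Not at hlt
    apply hne
    have h1 : (h⁻¹ * g) p = p := by
      refine hball _ ⟨h⁻¹ * g, mul_mem (inv_mem hh) hg, rfl⟩ ?_
      have : dist (h ((h⁻¹ * g) p)) (h p) = dist ((h⁻¹ * g) p) p := h.dist_map _ _
      rw [← this]
      simpa [AffineIsometryEquiv.coe_mul] using hlt
    have h2 := congrArg h h1
    simpa [AffineIsometryEquiv.coe_mul] using h2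
  have hcl : IsClosed O := Metric.isClosed_of_pairwise_le_dist hε hsep
  have := Metric.finite_isBounded_inter_isClosed (K := Metric.closedBall (0 : W) r)
    (s := O) ⟨hd⟩ Metric.isBounded_closedBall hcl
  rwa [Set.inter_comm] at this

theorem translation_add {n : ℕ} (b c : EuclideanSpace ℝ (Fin n)) :
    translation b * translation c = translation (b + c) := by
  ext x : 1; simp [AffineIsometryEquiv.coe_mul, add_assoc]

theorem translation_zero {n : ℕ} : translation (0 : EuclideanSpace ℝ (Fin n)) = 1 := by
  ext x : 1; simp

theorem translation_pow {n : ℕ} (b : EuclideanSpace ℝ (Fin n)) (N : ℕ) :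
    translation b ^ N = translation (N • b) := by
  induction N with
  | zero => rw [pow_zero, zero_smul, translation_zero]
  | succ N ih => rw [pow_succ, ih, translation_add, succ_nsmul]

theorem translation_inv {n : ℕ} (b : EuclideanSpace ℝ (Fin n)) :
    (translation b)⁻¹ = translation (-b) := by
  rw [inv_eq_iff_mul_eq_one, translation_add, add_neg_cancel, translation_zero]

theorem translation_apply_zero {n : ℕ} (b : EuclideanSpace ℝ (Fin n)) : translation b 0 = b := by
  simp

namespace ObjectiveStructure

variable {d₁ d₂ : ℕ} (X : ObjectiveStructure d₁ d₂)

theorem act_mul (g h : X.grp) (x : Space d₁ d₂) : X.act (g * h) x = X.act g (X.act h x) := rfl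

theorem act_one (x : Space d₁ d₂) : X.act 1 x = x := rfl

theorem act_sub_act (g : X.grp) (x y : Space d₁ d₂) :
    X.act g x - X.act g y = X.rot g (x - y) :=
  ((X.act g).map_vsub x y).symm

theorem act_eq (g : X.grp) (x : Space d₁ d₂) : X.act g x = X.rot g x + X.act g 0 := by
  rw [← sub_eq_iff_eq_add, act_sub_act, sub_zero]

/-- The homomorphism `rot`. -/
noncomputable def rotHom : X.grp →* (Space d₁ d₂ ≃ₗᵢ[ℝ] Space d₁ d₂) where
  toFun := X.rot
  map_one' := rfl
  map_mul' _ _ := rfl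

/-- The translation lattice `T^N`. -/
noncomputable def lattice (N : ℕ) : Subgroup X.grp := Subgroup.closure (powSet X.T N)

theorem average_eq (N : ℕ) (F : X.grp → ℝ) : X.average N F = cosetAverage (X.lattice N) F := rfl

variable {X} in
theorem mem_lattice {N : ℕ} (hN : N ∈ normalExponents X.T) {g : X.grp} :
    g ∈ X.lattice N ↔ ∃ t ∈ X.T, t ^ N = g := by
  rw [← SetLike.mem_coe, lattice, hN.2.1]
  rfl

variable {X} in
theorem lattice_normal {N : ℕ} (hN : N ∈ normalExponents X.T) : (X.lattice N).Normal := hN.2.2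

variable {X} in
theorem isPeriodicWith_iff {S : Type*} {N : ℕ} (hN : N ∈ normalExponents X.T) {u : X.grp → S} :
    X.IsPeriodicWith N u ↔ RightInvariant (X.lattice N) u := by
  refine ⟨fun h g t ht => ?_, fun h g t ht => h g _ ((mem_lattice hN).2 ⟨t, ht, rfl⟩)⟩
  obtain ⟨s, hs, rfl⟩ := (mem_lattice hN).1 ht
  exact h g s hs

theorem lattice_mul_le {N : ℕ} (hN : N ∈ normalExponents X.T) {k : ℕ} :
    X.lattice (N * k) ≤ X.lattice N := by
  rw [lattice, Subgroup.closure_le]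
  rintro _ ⟨t, ht, rfl⟩
  simp only [pow_mul]
  exact pow_mem ((mem_lattice hN).2 ⟨t, ht, rfl⟩) k

theorem exists_translation {t : X.grp} (ht : t ∈ X.T) : ∃ b, X.proj t = translation b :=
  (X.bijOn_T.mapsTo ht).2

theorem exists_mem_T {b : EuclideanSpace ℝ (Fin d₂)}
    (hb : translation b ∈ X.grp.map (MonoidHom.snd _ _)) : ∃ t ∈ X.T, X.proj t = translation b :=
  X.bijOn_T.surjOn ⟨hb, b, rfl⟩

variable {X} in
theorem proj_lattice {N : ℕ} (hN : N ∈ normalExponents X.T) {g : X.grp} (hg : g ∈ X.lattice N) :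
    ∃ b, X.proj g = translation b := by
  obtain ⟨t, ht, rfl⟩ := (mem_lattice hN).1 hg
  obtain ⟨b, hb⟩ := X.exists_translation ht
  exact ⟨N • b, by rw [map_pow, hb, translation_pow]⟩

variable {X} in
-- The projection is injective on `T^N`: the vector of `t^N` is `N` times that of `t`, so it
-- vanishes only for the one `t ∈ T` above the identity. Its power is 1 because `1 ∈ T^N` must arise
-- from the same `t`. Commutativity of `T^N` follows from that of translations.
theorem eq_one_of_mem_lattice {N : ℕ} (hN : N ∈ normalExponents X.T) {g : X.grp}
    (hg : g ∈ X.lattice N) (h : X.proj g = 1) : g = 1 := by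
  have key : ∀ t ∈ X.T, X.proj (t ^ N) = 1 → X.proj t = 1 := by
    intro t ht h
    obtain ⟨b, hb⟩ := X.exists_translation ht
    rw [map_pow, hb, translation_pow] at h
    have h0 := congrArg (fun s : Euc d₂ => s 0) h
    simp only [translation_apply_zero] at h0
    have hb0 : N • b = 0 := h0
    rw [← Nat.cast_smul_eq_nsmul ℝ] at hb0
    have : b = 0 := (smul_eq_zero.1 hb0).resolve_left (by exact_mod_cast hN.1.ne')
    rw [hb, this, translation_zero]
  obtain ⟨t, ht, rfl⟩ := (mem_lattice hN).1 hg
  obtain ⟨s, hs, hs1⟩ := (mem_lattice hN).1 (one_mem (X.lattice N))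
  have h2 : t = s := X.bijOn_T.injOn ht hs
    ((key t ht h).trans (key s hs (by rw [hs1, map_one])).symm)
  rw [h2, hs1]

variable {X} in
theorem lattice_comm {N : ℕ} (hN : N ∈ normalExponents X.T) :
    ∀ a ∈ X.lattice N, ∀ b ∈ X.lattice N, a * b = b * a := by
  intro a ha b hb
  rw [← mul_inv_eq_one]
  refine eq_one_of_mem_lattice hN
    (mul_mem (mul_mem ha hb) (inv_mem (mul_mem hb ha))) ?_
  obtain ⟨x, hx⟩ := proj_lattice hN ha
  obtain ⟨y, hy⟩ := proj_lattice hN hb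
  rw [map_mul, map_inv, map_mul, map_mul, hx, hy, mul_inv_eq_one, translation_add,
    translation_add, add_comm]

/-- Elements of `O(d₁)` preserve the norm of the first component of `x₀`, so a bound on the
displacement in `ℝ^{d₂}` confines `g · x₀` to a ball. Discreteness of the orbit and triviality of
the stabilizer then give finiteness. -/
theorem finite_setOf_norm_proj_le (r : ℝ) : {g : X.grp | ‖X.proj g 0‖ ≤ r}.Finite := by
  have h := (X.discrete.finite_orbit_inter_closedBall X.x₀
    (‖X.x₀.fst‖ + (r + ‖X.x₀.snd‖))).preimage (f := fun g : X.grp => oplus d₁ d₂ g X.x₀)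
    X.injective.injOn
  refine h.subset fun g hg => ⟨⟨_, ⟨g, g.2, rfl⟩, rfl⟩, ?_⟩
  have hg' : ‖X.proj g 0‖ ≤ r := hg
  rw [mem_closedBall_zero_iff]
  have h1 : oplus d₁ d₂ g X.x₀ =
      WithLp.toLp 2 ((g : Orth d₁ × Euc d₂).1 X.x₀.fst, (g : Orth d₁ × Euc d₂).2 X.x₀.snd) := rfl
  have h2 : ‖(g : Orth d₁ × Euc d₂).2 X.x₀.snd‖ ≤ r + ‖X.x₀.snd‖ := by
    have h3 : dist ((g : Orth d₁ × Euc d₂).2 X.x₀.snd) ((g : Orth d₁ × Euc d₂).2 0) =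
      dist X.x₀.snd 0 := (g : Orth d₁ × Euc d₂).2.dist_map _ _
    rw [dist_eq_norm, dist_zero_right] at h3
    have h4 := norm_le_norm_add_norm_sub' ((g : Orth d₁ × Euc d₂).2 X.x₀.snd)
      ((g : Orth d₁ × Euc d₂).2 0)
    rw [h3] at h4
    exact h4.trans (add_le_add_left hg' _)
  have h5 : ‖(g : Orth d₁ × Euc d₂).1 X.x₀.fst‖ = ‖X.x₀.fst‖ := LinearIsometryEquiv.norm_map _ _
  change ‖oplus d₁ d₂ g X.x₀‖ ≤ _
  rw [h1, WithLp.prod_norm_eq_of_L2]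
  simp only [WithLp.toLp_fst, WithLp.toLp_snd]
  rw [h5, Real.sqrt_le_left (add_nonneg (norm_nonneg _) ((norm_nonneg _).trans h2))]
  nlinarith [norm_nonneg X.x₀.fst, norm_nonneg ((g : Orth d₁ × Euc d₂).2 X.x₀.snd)]

variable {X} in
-- Multiplying by an element of `T^N` brings any `g` to one that moves the origin by at most `N ∑
-- ‖bᵢ‖`, the size of a fundamental cell; there are finitely many such elements.
theorem lattice_finite {N : ℕ} (hN : N ∈ normalExponents X.T) :
    Finite (X.grp ⧸ X.lattice N) := by
  obtain ⟨-, b, hb, hbS⟩ := X.spaceGroup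
  have hcard : Fintype.card (Fin d₂) =
      Module.finrank ℝ (EuclideanSpace ℝ (Fin d₂)) := by simp
  let B := Module.Basis.mk hb (hb.span_eq_top_of_card_eq_finrank' hcard).ge
  have hB : ∀ i, B i = b i := fun i => by simp [B]
  set r : ℝ := N * ∑ i, ‖B i‖ with hr
  have hfin := X.finite_setOf_norm_proj_le r
  have : Finite {g : X.grp | ‖X.proj g 0‖ ≤ r} := hfin
  refine Finite.of_surjective
    (fun g : {g : X.grp | ‖X.proj g 0‖ ≤ r} => (QuotientGroup.mk (g : X.grp) : X.grp ⧸ X.lattice N))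
    fun c => ?_
  have hNpos : (0 : ℝ) < N := by exact_mod_cast hN.1
  -- move `g` by a lattice translation
  let y : EuclideanSpace ℝ (Fin d₂) := (X.proj c.out)⁻¹ 0
  let z : EuclideanSpace ℝ (Fin d₂) := (ZSpan.floor B ((N : ℝ)⁻¹ • y) : EuclideanSpace ℝ (Fin d₂))
  have hz : translation z ∈ X.grp.map (MonoidHom.snd (Orth d₁) (Euc d₂)) := by
    have hmem : z ∈ Submodule.span ℤ (Set.range B) := (ZSpan.floor B ((N : ℝ)⁻¹ • y)).2
    clear_value z
    induction hmem using Submodule.span_induction with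
    | mem x hx =>
      obtain ⟨i, rfl⟩ := hx
      rw [hB]
      exact hbS i
    | zero => rw [translation_zero]; exact one_mem _
    | add x x' _ _ h h' => rw [← translation_add]; exact mul_mem h h'
    | smul n x _ h =>
      have h1 : ∀ k : ℕ, translation (k • x) ∈ X.grp.map (MonoidHom.snd (Orth d₁) (Euc d₂)) :=
        fun k => by rw [← translation_pow]; exact pow_mem h k
      obtain ⟨k, rfl | rfl⟩ := n.eq_nat_or_neg
      · rw [natCast_zsmul]; exact h1 k
      · rw [neg_smul, natCast_zsmul, ← translation_inv]; exact inv_mem (h1 k)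
  obtain ⟨t, ht, htz⟩ := X.exists_mem_T hz
  refine ⟨⟨c.out * t ^ N, ?_⟩, ?_⟩
  · change ‖X.proj (c.out * t ^ N) 0‖ ≤ r
    have h1 : X.proj (c.out * t ^ N) 0 = X.proj c.out (N • z) := by
      rw [map_mul, map_pow, htz, translation_pow]
      simp [AffineIsometryEquiv.coe_mul]
    have h2 : X.proj c.out y = 0 := by
      change (X.proj c.out * (X.proj c.out)⁻¹) 0 = 0
      rw [mul_inv_cancel]
      rfl
    rw [h1, ← dist_zero_right, ← h2, AffineIsometryEquiv.dist_map, dist_comm, dist_eq_norm]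
    have h3 : y - N • z = (N : ℝ) • ZSpan.fract B ((N : ℝ)⁻¹ • y) := by
      rw [ZSpan.fract_apply, smul_sub, smul_inv_smul₀ hNpos.ne', Nat.cast_smul_eq_nsmul]
    rw [h3, norm_smul, Real.norm_of_nonneg hNpos.le, hr]
    exact mul_le_mul_of_nonneg_left (ZSpan.norm_fract_le B _) hNpos.le
  · change (QuotientGroup.mk (c.out * t ^ N) : X.grp ⧸ X.lattice N) = c
    rw [QuotientGroup.mk_mul_of_mem _ ((mem_lattice hN).2 ⟨t, ht, rfl⟩), QuotientGroup.out_eq']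

/-- The lattices `T^N` avoid any given finite set. -/
theorem exists_sparse_lattice (K : Set X.grp) (hK : K.Finite) :
    ∃ N ∈ normalExponents X.T, ∀ g ∈ K, g ∈ X.lattice N → g = 1 := by
  -- Only finitely many elements move the origin by at most 1, so the nonzero displacements are
  -- bounded away from zero.
  obtain ⟨ε, hε, hε'⟩ : ∃ ε > 0, ∀ t ∈ X.T, ‖X.proj t 0‖ < ε → X.proj t 0 = 0 := by
    have hfin := (X.finite_setOf_norm_proj_le 1).image fun g => ‖X.proj g 0‖
    have hfin' := hfin.subset (Set.sdiff_subset (t := {0}))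
    have hopen : IsOpen ((fun g => ‖X.proj g 0‖) '' {g : X.grp | ‖X.proj g 0‖ ≤ 1} \ {0})ᶜ :=
      hfin'.isClosed.isOpen_compl
    obtain ⟨ε, hε, h⟩ := Metric.isOpen_iff.1 hopen 0 (by simp)
    refine ⟨min ε 1, lt_min hε one_pos, fun t _ ht => ?_⟩
    by_contra h0
    have hball : ‖X.proj t 0‖ ∈ Metric.ball (0 : ℝ) ε := by
      simpa using ht.trans_le (min_le_left _ _)
    exact h hball ⟨⟨t, (ht.trans_le (min_le_right _ _)).le, rfl⟩, by simpa using h0⟩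
  obtain ⟨r, hr⟩ := (hK.image fun g => ‖X.proj g 0‖).bddAbove
  obtain ⟨N₀, h₀, h⟩ := X.exists_mul_mem_normalExponents
  -- With `k ε > r` and `N = N₀ (k + 1)`, a power `t ^ N` with nonzero translation vector moves the
  -- origin farther than any element of `K`.
  obtain ⟨k, hk⟩ := exists_nat_gt (r / ε)
  have hN := h (k + 1) k.succ_pos
  refine ⟨_, hN, fun g hg hgN => eq_one_of_mem_lattice hN hgN ?_⟩
  obtain ⟨t, ht, rfl⟩ := (mem_lattice hN).1 hgN
  obtain ⟨b, hb⟩ := X.exists_translation ht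
  have h1 : X.proj (t ^ (N₀ * (k + 1))) = translation ((N₀ * (k + 1)) • b) := by
    rw [map_pow, hb, translation_pow]
  have h2 : ‖X.proj (t ^ (N₀ * (k + 1))) 0‖ ≤ r := hr ⟨_, hg, rfl⟩
  rw [h1, translation_apply_zero, ← Nat.cast_smul_eq_nsmul ℝ, norm_smul, Real.norm_natCast] at h2
  have h3 : ‖b‖ < ε := by
    rw [div_lt_iff₀ hε] at hk
    have h4 : ((k : ℝ) + 1) ≤ ((N₀ * (k + 1) : ℕ) : ℝ) := by
      exact_mod_cast Nat.le_mul_of_pos_left (k + 1) h₀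
    have h5 := mul_le_mul_of_nonneg_right h4 (norm_nonneg b)
    have hk0 : (0 : ℝ) ≤ k := k.cast_nonneg
    by_contra hcon
    push Not at hcon
    have h6 := mul_le_mul_of_nonneg_left hcon (show (0 : ℝ) ≤ (k : ℝ) + 1 by positivity)
    nlinarith
  have h7 := hε' t ht (by rwa [hb, translation_apply_zero])
  rw [hb, translation_apply_zero] at h7
  rw [h1, h7, smul_zero, translation_zero]

end ObjectiveStructure

/-! ### Nonnegative quadratic forms of finite differences -/

section DifferenceForm

variable {G W : Type*} [Group G] [NormedAddCommGroup W] [NormedSpace ℝ W]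

/-- The twisted differences `ρ(h) u(gh) - u(g)`, `h ∈ s`. -/
def twistedDiff (ρ : G →* (W ≃ₗᵢ[ℝ] W)) (s : Finset G) (u : G → W) (g : G) : s → W :=
  fun h => ρ h (u (g * h)) - u g

variable (ρ : G →* (W ≃ₗᵢ[ℝ] W)) (s : Finset G)

theorem twistedDiff_add (u v : G → W) (g : G) :
    twistedDiff ρ s (u + v) g = twistedDiff ρ s u g + twistedDiff ρ s v g := by
  ext h
  simp only [twistedDiff, Pi.add_apply, map_add]
  abel

theorem twistedDiff_sub (u v : G → W) (g : G) :
    twistedDiff ρ s (u - v) g = twistedDiff ρ s u g - twistedDiff ρ s v g := by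
  ext h
  simp only [twistedDiff, Pi.sub_apply, map_sub]
  abel

theorem norm_twistedDiff_le {u : G → W} {g : G} {M : ℝ} (h1 : ‖u g‖ ≤ M)
    (h2 : ∀ h ∈ s, ‖u (g * h)‖ ≤ M) : ‖twistedDiff ρ s u g‖ ≤ 2 * M := by
  have hM : 0 ≤ M := (norm_nonneg _).trans h1
  refine (pi_norm_le_iff_of_nonneg (by positivity)).2 fun h => ?_
  refine (norm_sub_le _ _).trans ?_
  rw [LinearIsometryEquiv.norm_map]
  linarith [h2 h h.2]

/-- A twisted difference of a product of a scalar function and a vector field, expanded. -/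
theorem twistedDiff_smul (q : G → ℝ) (e : G → W) (g : G) :
    twistedDiff ρ s (fun g => q g • e g) g =
      q g • twistedDiff ρ s e g + fun h : s => (q (g * h) - q g) • ρ h (e (g * h)) := by
  ext h
  simp only [twistedDiff, Pi.add_apply, Pi.smul_apply, map_smul, smul_sub, sub_smul]
  abel

variable {ρ s}

theorem abs_bilin_le {Y : Type*} [NormedAddCommGroup Y] [NormedSpace ℝ Y] (Q : Y →L[ℝ] Y →L[ℝ] ℝ)
    {a b : Y} {A B : ℝ} (ha : ‖a‖ ≤ A) (hb : ‖b‖ ≤ B) : |Q a b| ≤ ‖Q‖ * A * B := by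
  refine (Q.le_opNorm₂ a b).trans ?_
  have := (norm_nonneg a).trans ha
  gcongr

/-- The local energy of a product `q • e`, up to a term in which `e` appears linearly. -/
theorem bilin_twistedDiff_smul (Q : (s → W) →L[ℝ] (s → W) →L[ℝ] ℝ) (hsym : ∀ a b, Q a b = Q b a)
    (q : G → ℝ) (e : G → W) (g : G) :
    Q (twistedDiff ρ s (fun g => q g • e g) g) (twistedDiff ρ s (fun g => q g • e g) g) =
      Q (twistedDiff ρ s e g) (twistedDiff ρ s (fun g => q g ^ 2 • e g) g) +
      (Q (fun h : s => (q (g * h) - q g) • ρ h (e (g * h)))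
          (fun h : s => (q (g * h) - q g) • ρ h (e (g * h))) -
        Q (twistedDiff ρ s e g) (fun h : s => (q (g * h) - q g) ^ 2 • ρ h (e (g * h)))) := by
  rw [twistedDiff_smul, twistedDiff_smul]
  set x := twistedDiff ρ s e g
  set z : s → W := fun h => (q (g * h) - q g) • ρ h (e (g * h)) with hz
  set z2 : s → W := fun h => (q (g * h) - q g) ^ 2 • ρ h (e (g * h)) with hz2
  -- With `δ = q(gh) - q(g)`, one has `q(gh)² - q(g)² = δ² + 2 q(g) δ`. The part `2 q(g) δ`
  -- reproduces the cross terms of the square, so only terms quadratic in `δ` remain.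
  have h1 : (fun h : s => (q (g * h) ^ 2 - q g ^ 2) • ρ h (e (g * h))) =
      z2 + (2 * q g) • z := by
    ext h
    simp only [hz, hz2, Pi.add_apply, Pi.smul_apply, smul_smul, ← add_smul]
    congr 1
    ring
  rw [h1]
  simp only [map_add, map_smul, add_apply, smul_apply, smul_eq_mul]
  rw [hsym z x]
  ring

/-- Both terms are quadratic in the increments of `q`. The factor 3 is 1 from the square plus 2 from
`‖De‖ ≤ 2M`. -/
theorem abs_bilin_remainder_le (Q : (s → W) →L[ℝ] (s → W) →L[ℝ] ℝ) {q : G → ℝ} {e : G → W} {g : G}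
    {M δ : ℝ} (hM : ∀ g, ‖e g‖ ≤ M) (hδ : 0 ≤ δ) (hq : ∀ h ∈ s, |q (g * h) - q g| ≤ δ) :
    Q (fun h : s => (q (g * h) - q g) • ρ h (e (g * h)))
          (fun h : s => (q (g * h) - q g) • ρ h (e (g * h))) -
        Q (twistedDiff ρ s e g) (fun h : s => (q (g * h) - q g) ^ 2 • ρ h (e (g * h))) ≤
      3 * ‖Q‖ * M ^ 2 * δ ^ 2 := by
  have hM0 : 0 ≤ M := (norm_nonneg _).trans (hM 1)
  have h1 : ‖fun h : s => (q (g * h) - q g) • ρ h (e (g * h))‖ ≤ δ * M := by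
    refine (pi_norm_le_iff_of_nonneg (by positivity)).2 fun h => ?_
    rw [norm_smul, LinearIsometryEquiv.norm_map, Real.norm_eq_abs]
    exact mul_le_mul (hq h h.2) (hM _) (norm_nonneg _) hδ
  have h2 : ‖fun h : s => (q (g * h) - q g) ^ 2 • ρ h (e (g * h))‖ ≤ δ ^ 2 * M := by
    refine (pi_norm_le_iff_of_nonneg (by positivity)).2 fun h => ?_
    rw [norm_smul, LinearIsometryEquiv.norm_map, Real.norm_eq_abs, abs_pow]
    exact mul_le_mul (pow_le_pow_left₀ (abs_nonneg _) (hq h h.2) 2) (hM _) (norm_nonneg _)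
      (by positivity)
  have h3 := norm_twistedDiff_le ρ s (u := e) (g := g) (hM g) fun h _ => hM _
  have h4 := (le_abs_self _).trans (abs_bilin_le Q h1 h1)
  have h5 := (neg_le_abs _).trans (abs_bilin_le Q h3 h2)
  linarith

/-- The energy `∑_{g ∈ K} Q(Du(g), Du(g))`. -/
noncomputable def sumEnergy (ρ : G →* (W ≃ₗᵢ[ℝ] W)) (s : Finset G) (Q : (s → W) →L[ℝ] (s → W) →L[ℝ] ℝ)
    (K : Finset G) (u : G → W) : ℝ :=
  ∑ g ∈ K, Q (twistedDiff ρ s u g) (twistedDiff ρ s u g)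

/-- Dropping a nonnegative energy of `u - v` leaves a quasi-triangle inequality for the energy. -/
theorem sumEnergy_parallelogram (Q : (s → W) →L[ℝ] (s → W) →L[ℝ] ℝ) (K : Finset G) (u v : G → W) :
    sumEnergy ρ s Q K (u + v) + sumEnergy ρ s Q K (u - v) =
      2 * sumEnergy ρ s Q K u + 2 * sumEnergy ρ s Q K v := by
  simp only [sumEnergy, Finset.mul_sum, ← Finset.sum_add_distrib]
  refine Finset.sum_congr rfl fun g _ => ?_
  rw [twistedDiff_add, twistedDiff_sub]
  simp only [map_add, map_sub, add_apply, sub_apply]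
  ring

variable [DecidableEq G]

/-- The points at which the differences of a function supported in `F` may not vanish. -/
def enlarge (s F : Finset G) : Finset G :=
  F ∪ (F ×ˢ s).image fun p => p.1 * p.2⁻¹

/-- The points `g` of the enlarged set for which `g` or some `gh`, `h ∈ s`, is not in `F`. -/
def boundary (s F : Finset G) : Finset G :=
  (enlarge s F).filter fun g => ¬(g ∈ F ∧ ∀ h ∈ s, g * h ∈ F)

theorem mem_enlarge {F : Finset G} {g : G} :
    g ∈ enlarge s F ↔ g ∈ F ∨ ∃ h ∈ s, g * h ∈ F := by
  simp only [enlarge, Finset.mem_union, Finset.mem_image, Finset.mem_product, Prod.exists]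
  refine or_congr_right ⟨?_, ?_⟩
  · rintro ⟨a, b, ⟨ha, hb⟩, rfl⟩
    exact ⟨b, hb, by simpa using ha⟩
  · rintro ⟨h, hh, hg⟩
    exact ⟨g * h, h, ⟨hg, hh⟩, by simp⟩

/-- A boundary point inside `F` is carried out of `F` by some `h ∈ s`. One outside `F` is `g' * h⁻¹`
for some `g' ∈ F`. The boundary is thus small when `F` is nearly invariant under `s` and `s⁻¹`. -/
theorem card_boundary_le (s F : Finset G) :
    (boundary s F).card ≤ ∑ h ∈ s, (F.filter fun g => g * h ∉ F).card +
      ∑ h ∈ s, (F.filter fun g => g * h⁻¹ ∉ F).card := by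
  have hsub : boundary s F ⊆ (s.biUnion fun h => F.filter fun g => g * h ∉ F) ∪
      s.biUnion fun h => (F.filter fun g => g * h⁻¹ ∉ F).image fun g => g * h⁻¹ := by
    intro g hg
    obtain ⟨h1, h2⟩ := Finset.mem_filter.1 hg
    rw [Finset.mem_union, Finset.mem_biUnion, Finset.mem_biUnion]
    by_cases hgF : g ∈ F
    · left
      simp only [hgF, true_and] at h2
      push Not at h2
      obtain ⟨h, hh, hn⟩ := h2
      exact ⟨h, hh, Finset.mem_filter.2 ⟨hgF, hn⟩⟩
    · right
      obtain ⟨h, hh, hgh⟩ := (mem_enlarge.1 h1).resolve_left hgF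
      exact ⟨h, hh, Finset.mem_image.2 ⟨g * h, Finset.mem_filter.2 ⟨hgh, by simpa using hgF⟩,
        by simp⟩⟩
  refine (Finset.card_le_card hsub).trans ((Finset.card_union_le _ _).trans ?_)
  exact add_le_add Finset.card_biUnion_le
    (Finset.card_biUnion_le.trans (Finset.sum_le_sum fun h _ => Finset.card_image_le))

/-- A sum over the enlarged set of terms which are controlled in the interior and on the
boundary. -/
theorem sum_enlarge_le {F : Finset G} {f n : G → ℝ} {A B : ℝ} (hA : 0 ≤ A)
    (h1 : ∀ g, g ∈ F → (∀ h ∈ s, g * h ∈ F) → f g ≤ A * n g ^ 2) (h2 : ∀ g, f g ≤ B) :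
    ∑ g ∈ enlarge s F, f g ≤ A * ∑ g ∈ F, n g ^ 2 + (boundary s F).card * B := by
  rw [← Finset.sum_filter_add_sum_filter_not (enlarge s F) fun g => g ∈ F ∧ ∀ h ∈ s, g * h ∈ F]
  refine add_le_add ?_ ?_
  · rw [Finset.mul_sum]
    refine (Finset.sum_le_sum fun g hg => ?_).trans (Finset.sum_le_sum_of_subset_of_nonneg
      (s := (enlarge s F).filter fun g => g ∈ F ∧ ∀ h ∈ s, g * h ∈ F) (fun g hg => ?_)
      fun g _ _ => by positivity)
    · have := (Finset.mem_filter.1 hg).2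
      exact h1 g this.1 this.2
    · exact (Finset.mem_filter.1 hg).2.1
  · refine (Finset.sum_le_sum fun g _ => h2 g).trans ?_
    rw [Finset.sum_const, nsmul_eq_mul]
    rfl

variable (ρ s) in
/-- The functions supported in `F`, with differences supported in `enlarge s F`. -/
theorem twistedDiff_eq_zero {F : Finset G} {u : G → W} (hu : ∀ g, g ∉ F → u g = 0) {g : G}
    (hg : g ∉ enlarge s F) : u g = 0 ∧ twistedDiff ρ s u g = 0 := by
  rw [mem_enlarge] at hg
  push Not at hg
  refine ⟨hu g hg.1, funext fun h => ?_⟩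
  simp [twistedDiff, hu g hg.1, hu _ (hg.2 h h.2)]

/-- Each summand is added by the parallelogram identity, dropping the nonnegative energy of the
difference; the constant doubles every time. -/
theorem sumEnergy_add_sum_le {Q : (s → W) →L[ℝ] (s → W) →L[ℝ] ℝ}
    (hpos : ∀ (K : Finset G) (v : G → W), (∀ g, g ∉ K → v g = 0 ∧ twistedDiff ρ s v g = 0) →
      0 ≤ sumEnergy ρ s Q K v) {ι : Type*} (t : Finset ι) {F : Finset G} (r : G → W)
    (w : ι → G → W) (hr : ∀ g, g ∉ F → r g = 0) (hw : ∀ i, ∀ g, g ∉ F → w i g = 0) :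
    sumEnergy ρ s Q (enlarge s F) (r + ∑ i ∈ t, w i) ≤
      2 ^ t.card * (sumEnergy ρ s Q (enlarge s F) r +
        ∑ i ∈ t, sumEnergy ρ s Q (enlarge s F) (w i)) := by
  classical
  induction t using Finset.induction_on with
  | empty => simp
  | insert i t hi ih =>
    rw [Finset.sum_insert hi, Finset.sum_insert hi, Finset.card_insert_of_notMem hi]
    have h0 : ∀ g, g ∉ F → (r + ∑ i ∈ t, w i) g = 0 := fun g hg => by
      rw [Pi.add_apply, hr g hg, Finset.sum_apply, Finset.sum_eq_zero fun i _ => hw i g hg, add_zero]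
    have h1 := sumEnergy_parallelogram (ρ := ρ) Q (enlarge s F) (r + ∑ i ∈ t, w i) (w i)
    have h2 := hpos (enlarge s F) ((r + ∑ i ∈ t, w i) - w i) fun g hg =>
      twistedDiff_eq_zero ρ s (F := F) (fun g hg => by
        rw [Pi.sub_apply, h0 g hg, hw i g hg, sub_zero]) hg
    have h3 := hpos (enlarge s F) (w i) fun g hg => twistedDiff_eq_zero ρ s (hw i) hg
    have h4 : r + (w i + ∑ i ∈ t, w i) = (r + ∑ i ∈ t, w i) + w i := by abel
    rw [h4]
    have h5 : (1 : ℝ) ≤ 2 ^ t.card := one_le_pow₀ (by norm_num)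
    rw [pow_succ]
    nlinarith

/-- If a quadratic form of differences is nonnegative and the functions `e i` belong to its kernel,
then the energy in `F` of a function which is locally close to a linear combination of the `e i` with
slowly varying coefficients is small, up to a boundary term. -/
theorem exists_sumEnergy_le {Q : (s → W) →L[ℝ] (s → W) →L[ℝ] ℝ} (hsym : ∀ a b, Q a b = Q b a)
    (hpos : ∀ (K : Finset G) (v : G → W), (∀ g, g ∉ K → v g = 0 ∧ twistedDiff ρ s v g = 0) →
      0 ≤ sumEnergy ρ s Q K v)
    {ι : Type*} [Fintype ι] (e : ι → G → W) {M : ℝ} (hM : ∀ i g, ‖e i g‖ ≤ M)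
    (hker : ∀ i (K : Finset G) (v : G → W), (∀ g, g ∉ K → v g = 0 ∧ twistedDiff ρ s v g = 0) →
      ∑ g ∈ K, Q (twistedDiff ρ s (e i) g) (twistedDiff ρ s v g) = 0) :
    ∃ C : ℝ, 0 ≤ C ∧ ∀ (F : Finset G) (v : G → W) (p : ι → G → ℝ) (n : G → ℝ) (L : ℝ),
      (∀ g, ‖v g - ∑ i, p i g • e i g‖ ≤ n g) →
      (∀ g, ∀ h ∈ s, ‖v (g * h) - ∑ i, p i (g * h) • e i (g * h)‖ ≤ n g) →
      (∀ i g, ∀ h ∈ s, |p i (g * h) - p i g| ≤ n g) →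
      (∀ g, ‖v g‖ ≤ L) → (∀ i g, |p i g| ≤ L) →
      sumEnergy ρ s Q F v ≤ C * (∑ g ∈ F, n g ^ 2 + (boundary s F).card * L ^ 2) := by
  set A : ℝ := 1 + Fintype.card ι * |M| with hA
  have hA0 : 0 ≤ A := by positivity
  set C₀ : ℝ := ‖Q‖ * 4 * A ^ 2 + 4 * ‖Q‖ + Fintype.card ι * (12 * ‖Q‖ * M ^ 2) with hC₀
  have hC₀0 : 0 ≤ C₀ := by positivity
  refine ⟨8 * ‖Q‖ + 2 ^ Fintype.card ι * C₀, by positivity, fun F v p n L hn hn' hp hv hpL => ?_⟩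
  have hL0 : 0 ≤ L := (norm_nonneg _).trans (hv 1)
  have hn0 : ∀ g, 0 ≤ n g := fun g => (norm_nonneg _).trans (hn g)
  set S : ℝ := ∑ g ∈ F, n g ^ 2 with hS
  have hS0 : 0 ≤ S := Finset.sum_nonneg fun g _ => by positivity
  set b : ℝ := ((boundary s F).card : ℝ) with hb
  have hb0 : 0 ≤ b := Nat.cast_nonneg _
  -- A sharp cutoff suffices: it only alters differences at boundary points, each of which may cost
  -- a multiple of `L ^ 2`.
  let cut : G → ℝ := fun g => if g ∈ F then 1 else 0
  have cut_in : ∀ {g}, g ∈ F → cut g = 1 := fun h => if_pos h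
  have cut_out : ∀ {g}, g ∉ F → cut g = 0 := fun h => if_neg h
  have cut_abs : ∀ g, |cut g| ≤ 1 := fun g => by
    by_cases h : g ∈ F
    · rw [cut_in h, abs_one]
    · rw [cut_out h, abs_zero]; exact zero_le_one
  let us : G → W := fun g => ∑ i, p i g • e i g
  let r : G → W := fun g => cut g • (v g - us g)
  let w : ι → G → W := fun i g => (cut g * p i g) • e i g
  have hrw : (fun g => cut g • v g) = r + ∑ i, w i := by
    ext g
    simp only [r, w, us, Pi.add_apply, Finset.sum_apply, mul_smul, ← Finset.smul_sum, ← smul_add]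
    congr 1
    abel
  have hr : ∀ g, g ∉ F → r g = 0 := fun g hg => by simp only [r, cut_out hg, zero_smul]
  have hw : ∀ i, ∀ g, g ∉ F → w i g = 0 := fun i g hg => by
    simp only [w, cut_out hg, zero_mul, zero_smul]
  -- the remainder
  have hsup : ∀ g, ‖v g - us g‖ ≤ A * L := fun g => by
    have h1 : ‖us g‖ ≤ ∑ _i : ι, L * |M| :=
      (norm_sum_le _ _).trans (Finset.sum_le_sum fun i _ => by
        rw [norm_smul]
        exact mul_le_mul (hpL i g) ((hM i g).trans (le_abs_self M)) (norm_nonneg _) hL0)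
    rw [Finset.sum_const, Finset.card_univ, nsmul_eq_mul] at h1
    have h2 := norm_sub_le (v g) (us g)
    rw [hA]
    linarith [hv g]
  have hrb : ∀ g, ‖r g‖ ≤ A * L := fun g => by
    simp only [r]
    rw [norm_smul, Real.norm_eq_abs]
    exact (mul_le_of_le_one_left (norm_nonneg _) (cut_abs g)).trans (hsup g)
  have hEr : sumEnergy ρ s Q (enlarge s F) r ≤ (4 * ‖Q‖) * S + b * (‖Q‖ * 4 * A ^ 2 * L ^ 2) := by
    refine sum_enlarge_le (by positivity) (fun g hg hgh => ?_) fun g => ?_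
    · have h1 : ‖twistedDiff ρ s r g‖ ≤ 2 * n g := by
        refine norm_twistedDiff_le ρ s ?_ fun h hh => ?_
        · simp only [r, cut_in hg, one_smul]; exact hn g
        · simp only [r, cut_in (hgh h hh), one_smul]; exact hn' g h hh
      have h2 := (le_abs_self _).trans (abs_bilin_le Q h1 h1)
      linarith
    · have h1 : ‖twistedDiff ρ s r g‖ ≤ 2 * (A * L) :=
        norm_twistedDiff_le ρ s (hrb g) fun h _ => hrb _
      have h2 := (le_abs_self _).trans (abs_bilin_le Q h1 h1)
      linarith
  -- the products
  have hEw : ∀ i, sumEnergy ρ s Q (enlarge s F) (w i) ≤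
      (3 * ‖Q‖ * M ^ 2) * S + b * (12 * ‖Q‖ * M ^ 2 * L ^ 2) := by
    intro i
    have h1 : sumEnergy ρ s Q (enlarge s F) (w i) = ∑ g ∈ enlarge s F,
        (Q (fun h : s => (cut (g * h) * p i (g * h) - cut g * p i g) • ρ h (e i (g * h)))
          (fun h : s => (cut (g * h) * p i (g * h) - cut g * p i g) • ρ h (e i (g * h))) -
        Q (twistedDiff ρ s (e i) g)
          (fun h : s => (cut (g * h) * p i (g * h) - cut g * p i g) ^ 2 • ρ h (e i (g * h)))) := by
      -- The linear term in `e i` is removed by testing the kernel property with `(cut · p i)² • e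
      -- i`, which is supported in `F`.
      have h2 := hker i (enlarge s F) (fun g => (cut g * p i g) ^ 2 • e i g) fun g hg =>
        twistedDiff_eq_zero ρ s (F := F) (u := fun g => (cut g * p i g) ^ 2 • e i g)
          (fun g hg => by simp [cut_out hg]) hg
      refine Eq.trans ?_ ((congrArg (· + _) h2).trans (zero_add _))
      rw [sumEnergy]
      simp only [← Finset.sum_add_distrib]
      exact Finset.sum_congr rfl fun g _ =>
        bilin_twistedDiff_smul Q hsym (fun g => cut g * p i g) (e i) g
    rw [h1]
    refine sum_enlarge_le (by positivity) (fun g hg hgh => ?_) fun g => ?_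
    · refine abs_bilin_remainder_le (q := fun g => cut g * p i g) Q (hM i) (hn0 g) fun h hh => ?_
      simp only [cut_in hg, cut_in (hgh h hh), one_mul]
      exact hp i g h hh
    · have hcp : ∀ g, |cut g * p i g| ≤ L := fun g => by
        rw [abs_mul]
        exact (mul_le_of_le_one_left (abs_nonneg _) (cut_abs g)).trans (hpL i g)
      -- On the boundary the increments are only bounded by `2L`, and `3 (2L)² = 12 L²`.
      have h3 := abs_bilin_remainder_le (q := fun g => cut g * p i g) (ρ := ρ) (g := g) Q (hM i)
        (δ := 2 * L) (by positivity) fun h _ =>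
          (abs_sub _ _).trans (by linarith [hcp (g * h), hcp g])
      refine h3.trans (le_of_eq ?_)
      ring
  -- the total energy
  have htot : sumEnergy ρ s Q (enlarge s F) (fun g => cut g • v g) ≤
      2 ^ Fintype.card ι * (C₀ * (S + b * L ^ 2)) := by
    rw [hrw]
    refine (sumEnergy_add_sum_le hpos Finset.univ r w hr hw).trans ?_
    rw [Finset.card_univ]
    refine mul_le_mul_of_nonneg_left ?_ (by positivity)
    have h1 : ∑ i, sumEnergy ρ s Q (enlarge s F) (w i) ≤
        Fintype.card ι * ((3 * ‖Q‖ * M ^ 2) * S + b * (12 * ‖Q‖ * M ^ 2 * L ^ 2)) := by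
      refine (Finset.sum_le_sum fun i _ => hEw i).trans (le_of_eq ?_)
      rw [Finset.sum_const, Finset.card_univ, nsmul_eq_mul]
    have h2 : 0 ≤ ‖Q‖ * 4 * A ^ 2 * S := by positivity
    have h3 : 0 ≤ 4 * ‖Q‖ * (b * L ^ 2) := by positivity
    have h4 : 0 ≤ Fintype.card ι * (9 * ‖Q‖ * M ^ 2 * S) := by positivity
    rw [hC₀]
    linarith
  -- comparison with the energy without cutoff
  have hcmp : sumEnergy ρ s Q F v ≤ sumEnergy ρ s Q (enlarge s F) (fun g => cut g • v g) +
      b * (8 * ‖Q‖ * L ^ 2) := by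
    have hloc : ∀ u : G → W, (∀ g, ‖u g‖ ≤ L) → ∀ g,
        |Q (twistedDiff ρ s u g) (twistedDiff ρ s u g)| ≤ 4 * ‖Q‖ * L ^ 2 := fun u hu g => by
      have h1 := norm_twistedDiff_le ρ s (hu g) fun h _ => hu (g * h)
      refine (abs_bilin_le Q h1 h1).trans (le_of_eq ?_)
      ring
    have hcv : ∀ g, ‖cut g • v g‖ ≤ L := fun g => by
      rw [norm_smul, Real.norm_eq_abs]
      exact (mul_le_of_le_one_left (norm_nonneg _) (cut_abs g)).trans (hv g)
    -- The difference of the two local energies vanishes at interior points and is at most `(4 + 4)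
    -- ‖Q‖ L²` elsewhere.
    let f : G → ℝ := fun g => (if g ∈ F then Q (twistedDiff ρ s v g) (twistedDiff ρ s v g) else 0) -
      Q (twistedDiff ρ s (fun g => cut g • v g) g) (twistedDiff ρ s (fun g => cut g • v g) g)
    have h1 : ∑ g ∈ enlarge s F, f g ≤ 0 * ∑ g ∈ F, n g ^ 2 +
        (boundary s F).card * (8 * ‖Q‖ * L ^ 2) := by
      refine sum_enlarge_le le_rfl (fun g hg hgh => ?_) fun g => ?_
      · have h2 : twistedDiff ρ s (fun g => cut g • v g) g = twistedDiff ρ s v g := by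
          ext h
          simp only [twistedDiff, cut_in hg, cut_in (hgh h h.2), one_smul]
        simp only [f, if_pos hg, h2]
        simp
      · have h2 := (abs_le.1 (hloc v hv g)).2
        have h3 := (abs_le.1 (hloc _ hcv g)).1
        have h4 : 0 ≤ ‖Q‖ * L ^ 2 := by positivity
        simp only [f]
        split_ifs <;> linarith
    have h2 : ∑ g ∈ enlarge s F, f g = sumEnergy ρ s Q F v -
        sumEnergy ρ s Q (enlarge s F) (fun g => cut g • v g) := by
      simp only [f, Finset.sum_sub_distrib, Finset.sum_ite_mem]
      rw [Finset.inter_eq_right.2 (fun g hg => mem_enlarge.2 (Or.inl hg) : F ⊆ enlarge s F)]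
      rfl
    rw [h2, zero_mul, zero_add] at h1
    linarith
  have h5 : 0 ≤ 8 * ‖Q‖ * S := by positivity
  have h6 : (8 * ‖Q‖ + 2 ^ Fintype.card ι * C₀) * (S + b * L ^ 2) =
    8 * ‖Q‖ * S + b * (8 * ‖Q‖ * L ^ 2) + 2 ^ Fintype.card ι * (C₀ * (S + b * L ^ 2)) := by ring
  linarith

end DifferenceForm

/-! ### Rotation invariant functions -/

section RotationInvariance

set_option linter.unusedSectionVars false

variable {W : Type*} [NormedAddCommGroup W] [InnerProductSpace ℝ W] [FiniteDimensional ℝ W]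
  {κ : Type*} [Fintype κ]

/-- The componentwise action of a linear map. -/
noncomputable def componentwise (κ : Type*) [Fintype κ] (S : W →L[ℝ] W) : (κ → W) →L[ℝ] (κ → W) :=
  ContinuousLinearMap.pi fun k => S.comp (ContinuousLinearMap.proj k)

theorem componentwise_apply (S : W →L[ℝ] W) (z : κ → W) (k : κ) :
    componentwise κ S z k = S (z k) := rfl

/-- The exponential of a skew map is orthogonal, so `t ↦ Ψ(exp(tS) z)` is constant; its derivative
at 0 is the claim. -/
theorem fderiv_apply_skew_eq_zero {Ψ : (κ → W) → ℝ} (hΨ : Differentiable ℝ Ψ)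
    (hinv : ∀ (A : W ≃ₗᵢ[ℝ] W) (z : κ → W), Ψ (fun k => A (z k)) = Ψ z) (S : W →L[ℝ] W)
    (hS : ∀ x y, ⟪S x, y⟫ = -⟪x, S y⟫) (z : κ → W) : fderiv ℝ Ψ z (componentwise κ S z) = 0 := by
  have hadj : ∀ t : ℝ, t • S ∈ skewAdjoint (W →L[ℝ] W) := fun t => by
    refine skewAdjoint.smul_mem t (skewAdjoint.mem_iff.2 ?_)
    rw [ContinuousLinearMap.star_eq_adjoint]
    symm
    rw [ContinuousLinearMap.eq_adjoint_iff]
    intro x y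
    rw [neg_apply, inner_neg_left, hS, neg_neg]
  let _ : NormedAlgebra ℚ (W →L[ℝ] W) := NormedAlgebra.restrictScalars ℚ ℝ _
  have hU : ∀ t : ℝ, NormedSpace.exp (t • S) ∈ unitary (W →L[ℝ] W) := fun t =>
    NormedSpace.exp_mem_unitary_of_mem_skewAdjoint (hadj t)
  have hconst : ∀ t : ℝ, Ψ (componentwise κ (NormedSpace.exp (t • S)) z) = Ψ z := fun t =>
    hinv (Unitary.linearIsometryEquiv ⟨_, hU t⟩) z
  have hd : HasDerivAt (fun t : ℝ => componentwise κ (NormedSpace.exp (t • S)) z)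
      (componentwise κ S z) 0 := by
    rw [hasDerivAt_pi]
    intro k
    have h1 := hasDerivAt_exp_smul_const (𝕂 := ℝ) S (0 : ℝ)
    have h2 := h1.clm_apply (hasDerivAt_const (0 : ℝ) (z k))
    simpa [componentwise_apply] using h2
  have h0 : componentwise κ (NormedSpace.exp ((0 : ℝ) • S)) z = z := by
    ext k
    simp [componentwise_apply]
  have h3 := ((hΨ _).hasFDerivAt (x := componentwise κ (NormedSpace.exp ((0 : ℝ) • S)) z)).comp_hasDerivAt
    (0 : ℝ) hd
  rw [h0] at h3
  have h4 : HasDerivAt (fun t : ℝ => Ψ (componentwise κ (NormedSpace.exp (t • S)) z)) 0 0 := by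
    simp only [hconst]
    exact hasDerivAt_const _ _
  exact h3.unique h4

/-- The second derivative of a rotation invariant function in the direction of an infinitesimal
rotation. -/
theorem fderiv_fderiv_apply_skew {Ψ : (κ → W) → ℝ} (hΨ : ContDiff ℝ 2 Ψ)
    (hinv : ∀ (A : W ≃ₗᵢ[ℝ] W) (z : κ → W), Ψ (fun k => A (z k)) = Ψ z) (S : W →L[ℝ] W)
    (hS : ∀ x y, ⟪S x, y⟫ = -⟪x, S y⟫) (y z : κ → W) :
    fderiv ℝ (fderiv ℝ Ψ) y z (componentwise κ S y) = -fderiv ℝ Ψ y (componentwise κ S z) := by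
  have hd : ContDiff ℝ 1 (fderiv ℝ Ψ) := hΨ.fderiv_right (by norm_num)
  have h1 := ((hd.differentiable one_ne_zero y).hasFDerivAt).clm_apply
    (componentwise κ S).hasFDerivAt
  -- The identity `Ψ'(y)(S y) = 0` holds for all `y`, so it may be differentiated in direction `z`.
  have h2 : (fun y => fderiv ℝ Ψ y (componentwise κ S y)) = fun _ => 0 := funext fun y =>
    fderiv_apply_skew_eq_zero (hΨ.differentiable two_ne_zero) hinv S hS y
  rw [h2] at h1
  have h3 := congrArg (fun L => L z) (h1.unique (hasFDerivAt_const (0 : ℝ) y))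
  simp only [add_apply, ContinuousLinearMap.comp_apply,
    ContinuousLinearMap.flip_apply, zero_apply] at h3
  linarith

/-- The expansion at a constant configuration of a function on a space of bounded functions which is
given by a rotation invariant local density. -/
theorem exists_expansion_of_invariant {α U : Type*} [NormedAddCommGroup U] [NormedSpace ℝ U]
    {Ψ : (κ → W) → ℝ} (hΨ : ContDiff ℝ 2 Ψ)
    (hinv : ∀ (A : W ≃ₗᵢ[ℝ] W) (z : κ → W), Ψ (fun k => A (z k)) = Ψ z)
    (m : lp (fun _ : α => ℝ) ∞ →L[ℝ] ℝ) (D : U →L[ℝ] lp (fun _ : α => κ → W) ∞)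
    (c : lp (fun _ : α => κ → W) ∞) (w₀ : U) (y₀ : κ → W) (hy₀ : ∀ a, (D w₀ + c) a = y₀)
    {E : U → ℝ} (hE : ∀ w, E w = m (superpose α Ψ hΨ.continuous (D w + c))) :
    ContDiff ℝ 2 E ∧ ∃ (f : (κ → W) →L[ℝ] ℝ) (Q : (κ → W) →L[ℝ] (κ → W) →L[ℝ] ℝ),
      (∀ v, ∃ F : lp (fun _ : α => ℝ) ∞, (F : α → ℝ) = (fun a => f (D v a)) ∧
        fderiv ℝ E w₀ v = m F) ∧
      (∀ u v, ∃ F : lp (fun _ : α => ℝ) ∞, (F : α → ℝ) = (fun a => Q (D u a) (D v a)) ∧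
        fderiv ℝ (fderiv ℝ E) w₀ u v = m F) ∧
      (∀ a b, Q a b = Q b a) ∧
      ∀ S : W →ₗ[ℝ] W, (∀ x y, ⟪S x, y⟫ = -⟪x, S y⟫) → ∀ z : κ → W,
        Q (fun k => S (y₀ k)) z = -f fun k => S (z k) := by
  obtain ⟨hC2, hD2⟩ := superpose_functional_fderiv_two m D c Ψ hΨ
  have hD1 := superpose_functional_fderiv m D c Ψ (hΨ.of_le (by norm_num))
  rw [← funext hE] at hC2 hD2 hD1
  have hsymm : ∀ a b, fderiv ℝ (fderiv ℝ Ψ) y₀ a b = fderiv ℝ (fderiv ℝ Ψ) y₀ b a := fun a b =>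
    (hΨ.contDiffAt.isSymmSndFDerivAt (by simp)).eq a b
  refine ⟨hC2, fderiv ℝ Ψ y₀, fderiv ℝ (fderiv ℝ Ψ) y₀, fun v => ⟨_, ?_, hD1 w₀ v⟩,
    fun u v => ⟨_, ?_, hD2 w₀ u v⟩, hsymm, fun S hS z => ?_⟩
  · funext a
    rw [pointwiseApply_apply, superpose_apply, hy₀]
  · funext a
    rw [pointwiseApply_apply, pointwiseApply_apply, superpose_apply, hy₀]
  · rw [hsymm]
    exact fderiv_fderiv_apply_skew hΨ hinv (LinearMap.toContinuousLinearMap S) hS y₀ z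

end RotationInvariance

namespace ObjectiveStructure

variable {d₁ d₂ : ℕ} (X : ObjectiveStructure d₁ d₂)

/-! ### The mean value of a periodic function -/

/-- Both averages agree with the one for the common period `N₀ (N M)`. The factor `N₀` ensures
membership in `M₀`, which `N M` alone is not known to have. -/
theorem average_congr_period {N M : ℕ} (hN : N ∈ normalExponents X.T) (hM : M ∈ normalExponents X.T)
    {F : X.grp → ℝ} (hFN : X.IsPeriodicWith N F) (hFM : X.IsPeriodicWith M F) :
    X.average N F = X.average M F := by
  obtain ⟨N₀, h₀, h⟩ := X.exists_mul_mem_normalExponents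
  have key : ∀ {N M : ℕ}, N ∈ normalExponents X.T → M ∈ normalExponents X.T →
      X.IsPeriodicWith N F → X.average (N₀ * (N * M)) F = X.average N F := by
    intro N M hN hM hF
    have hNM := h (N * M) (Nat.mul_pos hN.1 hM.1)
    have := lattice_finite hN
    have := lattice_finite hNM
    have hle : X.lattice (N₀ * (N * M)) ≤ X.lattice N := by
      rw [show N₀ * (N * M) = N * (N₀ * M) by ring]
      exact X.lattice_mul_le hN
    exact cosetAverage_of_le hle ((isPeriodicWith_iff hN).1 hF)
  rw [← key hN hM hFN, ← key hM hN hFM, mul_comm N M]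

theorem exists_common_period {N M : ℕ} (hN : N ∈ normalExponents X.T)
    (hM : M ∈ normalExponents X.T) : ∃ P ∈ normalExponents X.T,
      (∀ {S : Type} {u : X.grp → S}, X.IsPeriodicWith N u → X.IsPeriodicWith P u) ∧
      ∀ {S : Type} {u : X.grp → S}, X.IsPeriodicWith M u → X.IsPeriodicWith P u := by
  obtain ⟨N₀, h₀, h⟩ := X.exists_mul_mem_normalExponents
  refine ⟨N₀ * (N * M), h _ (Nat.mul_pos hN.1 hM.1), fun hu => ?_, fun hu => ?_⟩
  · rw [show N₀ * (N * M) = N * (N₀ * M) by ring]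
    exact hu.mul _
  · rw [show N₀ * (N * M) = M * (N₀ * N) by ring]
    exact hu.mul _

/-- The bounded periodic real functions. -/
def periodicReal : Submodule ℝ (lp (fun _ : X.grp => ℝ) ∞) where
  carrier := {u | X.IsPeriodic (u : X.grp → ℝ)}
  zero_mem' := by
    obtain ⟨N₀, h₀, h⟩ := X.exists_mul_mem_normalExponents
    exact ⟨_, h 1 one_pos, fun _ _ _ => rfl⟩
  add_mem' := by
    rintro u v ⟨N, hN, hu⟩ ⟨M, hM, hv⟩
    obtain ⟨P, hP, h1, h2⟩ := X.exists_common_period hN hM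
    exact ⟨P, hP, fun g t ht => by
      simp only [lp.coeFn_add, Pi.add_apply, h1 hu g t ht, h2 hv g t ht]⟩
  smul_mem' := by
    rintro c u ⟨N, hN, hu⟩
    exact ⟨N, hN, fun g t ht => by simp only [lp.coeFn_smul, Pi.smul_apply, hu g t ht]⟩

theorem exists_period (f : X.periodicReal) : ∃ N ∈ normalExponents X.T,
    X.IsPeriodicWith N ((f : lp (fun _ : X.grp => ℝ) ∞) : X.grp → ℝ) := f.2

/-- The average of a periodic function. -/
noncomputable def averagePeriodic (f : X.periodicReal) : ℝ :=
  X.average (X.exists_period f).choose (f : lp (fun _ : X.grp => ℝ) ∞)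

theorem averagePeriodic_eq (f : X.periodicReal) {N : ℕ} (hN : N ∈ normalExponents X.T)
    (hf : X.IsPeriodicWith N ((f : lp (fun _ : X.grp => ℝ) ∞) : X.grp → ℝ)) :
    X.averagePeriodic f = X.average N (f : lp (fun _ : X.grp => ℝ) ∞) :=
  X.average_congr_period (X.exists_period f).choose_spec.1 hN (X.exists_period f).choose_spec.2 hf

theorem averagePeriodic_add (f f' : X.periodicReal) :
    X.averagePeriodic (f + f') = X.averagePeriodic f + X.averagePeriodic f' := by
  obtain ⟨N, hN, hf⟩ := X.exists_period f
  obtain ⟨M, hM, hf'⟩ := X.exists_period f'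
  obtain ⟨P, hP, h1, h2⟩ := X.exists_common_period hN hM
  have h3 : X.IsPeriodicWith P ((f + f' : X.periodicReal) : lp (fun _ : X.grp => ℝ) ∞) :=
    fun g t ht => by
      simp only [Submodule.coe_add, lp.coeFn_add, Pi.add_apply, h1 hf g t ht, h2 hf' g t ht]
  rw [X.averagePeriodic_eq _ hP h3, X.averagePeriodic_eq _ hP (h1 hf),
    X.averagePeriodic_eq _ hP (h2 hf')]
  have := lattice_finite hP
  simp only [average_eq]
  exact cosetAverage_add _ _ _

theorem averagePeriodic_smul (c : ℝ) (f : X.periodicReal) :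
    X.averagePeriodic (c • f) = c * X.averagePeriodic f := by
  obtain ⟨N, hN, hf⟩ := X.exists_period f
  have h3 : X.IsPeriodicWith N ((c • f : X.periodicReal) : lp (fun _ : X.grp => ℝ) ∞) :=
    fun g t ht => by
      simp only [Submodule.coe_smul, lp.coeFn_smul, Pi.smul_apply, hf g t ht]
  rw [X.averagePeriodic_eq _ hN h3, X.averagePeriodic_eq _ hN hf]
  have := lattice_finite hN
  simp only [average_eq]
  exact cosetAverage_mul_left _ _ _

theorem abs_averagePeriodic_le (f : X.periodicReal) : |X.averagePeriodic f| ≤ ‖f‖ := by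
  obtain ⟨N, hN, hf⟩ := X.exists_period f
  have := lattice_finite hN
  rw [X.averagePeriodic_eq _ hN hf, average_eq]
  exact abs_cosetAverage_le _ fun g => lp_norm_apply_le (f : lp (fun _ : X.grp => ℝ) ∞) g

/-- The average of periodic functions extends to a continuous linear functional. -/
theorem exists_mean : ∃ m : lp (fun _ : X.grp => ℝ) ∞ →L[ℝ] ℝ, ∀ N ∈ normalExponents X.T,
    ∀ f : lp (fun _ : X.grp => ℝ) ∞, X.IsPeriodicWith N (f : X.grp → ℝ) → m f = X.average N f := by
  let m₀ : X.periodicReal →ₗ[ℝ] ℝ :=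
    { toFun := X.averagePeriodic
      map_add' := X.averagePeriodic_add
      map_smul' := X.averagePeriodic_smul }
  -- By Hahn–Banach the mean becomes a functional on all bounded functions, the target of the
  -- superposition operators.
  obtain ⟨m, hm, -⟩ := exists_extension_norm_eq X.periodicReal
    (m₀.mkContinuous 1 fun f => by rw [one_mul]; exact X.abs_averagePeriodic_le f)
  refine ⟨m, fun N hN f hf => ?_⟩
  exact (hm ⟨f, N, hN, hf⟩).trans (X.averagePeriodic_eq ⟨f, N, hN, hf⟩ hN hf)

/-! ### Expansion of the energy -/

variable {X} in
theorem period_mem (u : X.Uper) : X.period u ∈ normalExponents X.T := u.2.choose_spec.1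

variable {X} in
theorem isPeriodicWith_period (u : X.Uper) : X.IsPeriodicWith (X.period u) (X.fn u) :=
  u.2.choose_spec.2

theorem norm_fn_le (u : X.Uper) (g : X.grp) : ‖X.fn u g‖ ≤ ‖u‖ :=
  lp_norm_apply_le (u : lp (fun _ : X.grp => Space d₁ d₂) ∞) g

variable {X} in
-- Take `Ψ(z) = V(z extended by zero)`. Extension by zero is a linear map from a finite-dimensional
-- space into the bounded functions, hence continuous, so `Ψ` inherits the regularity of `V`.
theorem exists_local_potential {V : ({g : X.grp // g ≠ 1} → Space d₁ d₂) → ℝ}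
    (hV : X.IsInteractionPotential V) :
    ∃ (s : Finset X.grp) (hs : ∀ h ∈ s, h ≠ 1) (Ψ : (s → Space d₁ d₂) → ℝ), ContDiff ℝ 2 Ψ ∧
      (∀ (A : Space d₁ d₂ ≃ₗᵢ[ℝ] Space d₁ d₂) (z : s → Space d₁ d₂),
        Ψ (fun h => A (z h)) = Ψ z) ∧
      ∀ y, V y = Ψ fun h => y ⟨h, hs h h.2⟩ := by
  classical
  obtain ⟨RV, hfin, hRV⟩ := hV.finite_range
  let s : Finset X.grp := hfin.toFinset.image Subtype.val
  have hs : ∀ h ∈ s, h ≠ 1 := fun h hh => by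
    obtain ⟨k, -, rfl⟩ := Finset.mem_image.1 hh
    exact k.2
  have hmem : ∀ h : {g : X.grp // g ≠ 1}, (h : X.grp) ∈ s ↔ h ∈ RV := fun h => by
    simp only [s, Finset.mem_image, Set.Finite.mem_toFinset]
    constructor
    · rintro ⟨k, hk, hkh⟩
      rwa [← Subtype.ext hkh]
    · exact fun hh => ⟨h, hh, rfl⟩
  let ext : (s → Space d₁ d₂) →ₗ[ℝ] lp (fun _ : {g : X.grp // g ≠ 1} => Space d₁ d₂) ∞ :=
    { toFun := fun z => boundedMk (fun g => if h : (g : X.grp) ∈ s then z ⟨g, h⟩ else 0) ‖z‖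
        fun g => by
          split_ifs with h
          · exact norm_le_pi_norm z _
          · rw [norm_zero]; exact norm_nonneg z
      map_add' := fun z z' => by
        ext1
        funext g
        change (if h : (g : X.grp) ∈ s then (z + z') ⟨g, h⟩ else 0) =
          (if h : (g : X.grp) ∈ s then z ⟨g, h⟩ else 0) +
          (if h : (g : X.grp) ∈ s then z' ⟨g, h⟩ else 0)
        split_ifs <;> simp
      map_smul' := fun c z => by
        ext1
        funext g
        change (if h : (g : X.grp) ∈ s then (c • z) ⟨g, h⟩ else 0) =
          c • (if h : (g : X.grp) ∈ s then z ⟨g, h⟩ else 0)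
        split_ifs <;> simp }
  have hext : ∀ z g, ext z g = if h : (g : X.grp) ∈ s then z ⟨g, h⟩ else 0 := fun z g => rfl
  refine ⟨s, hs, fun z => V (ext z), ?_, fun A z => ?_, fun y => ?_⟩
  · have h1 := (hV.contDiff 0).comp (LinearMap.toContinuousLinearMap ext).contDiff
    simpa [Function.comp_def] using h1
  · dsimp only
    rw [← hV.invariant A (ext z)]
    congr 1
    funext g
    rw [hext, hext]
    split_ifs <;> simp
  · rw [hRV y]
    congr 1
    funext g
    rw [hext]
    by_cases hg : g ∈ RV
    · rw [Set.indicator_of_mem hg, dif_pos ((hmem g).2 hg)]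
    · rw [Set.indicator_of_notMem hg, dif_neg fun h => hg ((hmem g).1 h)]

/-- The differences of a periodic function, as a bounded operator. -/
noncomputable def diffCLM (s : Finset X.grp) :
    X.Uper →L[ℝ] lp (fun _ : X.grp => s → Space d₁ d₂) ∞ :=
  LinearMap.mkContinuous
    { toFun := fun u => boundedMk (twistedDiff X.rotHom s (X.fn u)) (2 * ‖u‖) fun g =>
        norm_twistedDiff_le _ _ (X.norm_fn_le u g) fun h _ => X.norm_fn_le u _
      map_add' := fun u v => by
        ext1
        funext g
        exact twistedDiff_add X.rotHom s (X.fn u) (X.fn v) g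
      map_smul' := fun c u => by
        ext1
        funext g h
        change X.rot h (c • X.fn u (g * h)) - c • X.fn u g =
          c • (X.rot h (X.fn u (g * h)) - X.fn u g)
        rw [map_smul, smul_sub] } 2
    fun u => lp.norm_le_of_forall_le (by positivity) fun g =>
      norm_twistedDiff_le _ _ (X.norm_fn_le u g) fun h _ => X.norm_fn_le u _

theorem diffCLM_apply (s : Finset X.grp) (u : X.Uper) (g : X.grp) :
    X.diffCLM s u g = twistedDiff X.rotHom s (X.fn u) g := rfl

variable {X} in
theorem IsPeriodicWith.twistedDiff {N : ℕ} (hN : N ∈ normalExponents X.T)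
    {u : X.grp → Space d₁ d₂} (hu : X.IsPeriodicWith N u) (s : Finset X.grp) :
    X.IsPeriodicWith N (twistedDiff X.rotHom s u) := by
  rw [isPeriodicWith_iff hN] at hu ⊢
  have := lattice_normal hN
  intro g t ht
  funext h
  have h1 : u (g * t * h) = u (g * h) := hu.shift (h : X.grp) g t ht
  simp only [_root_.twistedDiff]
  rw [hu g t ht, h1]

/-- The inhomogeneous part of the differences `h · w(gh) - w(g)`. -/
noncomputable def actZero (s : Finset X.grp) : lp (fun _ : X.grp => s → Space d₁ d₂) ∞ :=
  boundedMk (fun _ h => X.act h 0) ‖fun h : s => X.act h 0‖ fun _ => le_rfl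

theorem diffCLM_add_actZero (s : Finset X.grp) (w : X.Uper) (g : X.grp) :
    (X.diffCLM s w + X.actZero s) g = fun h : s => X.act h (X.fn w (g * h)) - X.fn w g := by
  funext h
  change X.rot h (X.fn w (g * h)) - X.fn w g + X.act h 0 = _
  rw [X.act_eq h (X.fn w (g * h))]
  abel

theorem diffCLM_refConfig_add_actZero (s : Finset X.grp) (g : X.grp) :
    (X.diffCLM s X.refConfig + X.actZero s) g = fun h : s => X.act h X.x₀ - X.x₀ :=
  X.diffCLM_add_actZero s X.refConfig g

/-- Since `(gh)·w(gh) - g·w(g) = rot(g)(h·w(gh) - w(g))`, invariance of `V` removes `rot(g)` and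
leaves a density not depending explicitly on `g`. -/
theorem energy_eq_mean {V : ({g : X.grp // g ≠ 1} → Space d₁ d₂) → ℝ}
    (hV : X.IsInteractionPotential V) {s : Finset X.grp} (hs : ∀ h ∈ s, h ≠ 1)
    {Ψ : (s → Space d₁ d₂) → ℝ} (hΨ : Continuous Ψ) (hVΨ : ∀ y, V y = Ψ fun h => y ⟨h, hs h h.2⟩)
    {m : lp (fun _ : X.grp => ℝ) ∞ →L[ℝ] ℝ} (hm : ∀ N ∈ normalExponents X.T,
      ∀ f : lp (fun _ : X.grp => ℝ) ∞, X.IsPeriodicWith N (f : X.grp → ℝ) → m f = X.average N f)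
    (w : X.Uper) : X.energy V w = m (superpose X.grp Ψ hΨ (X.diffCLM s w + X.actZero s)) := by
  have hN := period_mem w
  have hsup : ((superpose X.grp Ψ hΨ (X.diffCLM s w + X.actZero s) : lp _ ∞) : X.grp → ℝ) =
      fun g => Ψ fun h : s => X.act h (X.fn w (g * h)) - X.fn w g := by
    funext g
    rw [superpose_apply, diffCLM_add_actZero]
  have hw := (isPeriodicWith_iff hN).1 (isPeriodicWith_period w)
  have := lattice_normal hN
  rw [hm _ hN, hsup, energy]
  · congr 1
    funext g
    have h1 : ∀ h : X.grp, X.act (g * h) (X.fn w (g * h)) - X.act g (X.fn w g) =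
        X.rot g (X.act h (X.fn w (g * h)) - X.fn w g) := fun h => by
      rw [act_mul, act_sub_act]
    simp only [h1]
    rw [hV.invariant (X.rot g) fun h => X.act h (X.fn w (g * h)) - X.fn w g, hVΨ]
  · rw [hsup, isPeriodicWith_iff hN]
    intro g t ht
    have h2 : ∀ h, X.fn w (g * t * h) = X.fn w (g * h) := fun h => hw.shift h g t ht
    simp only [h2, hw g t ht]

set_option maxHeartbeats 1000000 in
/-- The first two derivatives of the energy at the identity deformation. -/
theorem exists_energy_expansion {V : ({g : X.grp // g ≠ 1} → Space d₁ d₂) → ℝ}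
    (hV : X.IsInteractionPotential V) :
    ContDiff ℝ 2 (X.energy V) ∧
    ∃ (s : Finset X.grp) (f : (s → Space d₁ d₂) →L[ℝ] ℝ)
      (Q : (s → Space d₁ d₂) →L[ℝ] (s → Space d₁ d₂) →L[ℝ] ℝ),
      (∀ (v : X.Uper), ∀ N ∈ normalExponents X.T, X.IsPeriodicWith N (X.fn v) →
        X.energyDeriv V v = X.average N fun g => f (twistedDiff X.rotHom s (X.fn v) g)) ∧
      (∀ (u v : X.Uper), ∀ N ∈ normalExponents X.T, X.IsPeriodicWith N (X.fn u) →
        X.IsPeriodicWith N (X.fn v) → X.energyHess V u v = X.average N fun g =>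
          Q (twistedDiff X.rotHom s (X.fn u) g) (twistedDiff X.rotHom s (X.fn v) g)) ∧
      (∀ a b, Q a b = Q b a) ∧
      ∀ S ∈ skewZeroZero d₁ d₂, ∀ z : s → Space d₁ d₂,
        Q (fun h => S (X.act h X.x₀ - X.x₀)) z = -f fun h => S (z h) := by
  obtain ⟨s, hs, Ψ, hΨ, hinv, hVΨ⟩ := exists_local_potential hV
  obtain ⟨m, hm⟩ := X.exists_mean
  obtain ⟨hC2, f, Q, h1, h2, hsymm, hskew⟩ := exists_expansion_of_invariant hΨ hinv m (X.diffCLM s)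
    (X.actZero s) X.refConfig (fun h : s => X.act h X.x₀ - X.x₀)
    (X.diffCLM_refConfig_add_actZero s) (X.energy_eq_mean hV hs hΨ.continuous hVΨ hm)
  refine ⟨hC2, s, f, Q, fun v N hN hv => ?_, fun u v N hN hu hv => ?_, hsymm,
    fun S hS z => hskew S hS.1 z⟩
  · obtain ⟨F, hF, hmF⟩ := h1 v
    have hper : X.IsPeriodicWith N (F : X.grp → ℝ) := fun g t ht => by
      simp only [hF, diffCLM_apply, hv.twistedDiff hN s g t ht]
    rw [energyDeriv, hmF, hm N hN F hper, hF]
    rfl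
  · obtain ⟨F, hF, hmF⟩ := h2 u v
    have hper : X.IsPeriodicWith N (F : X.grp → ℝ) := fun g t ht => by
      simp only [hF, diffCLM_apply, hu.twistedDiff hN s g t ht, hv.twistedDiff hN s g t ht]
    rw [energyHess, hmF, hm N hN F hper, hF]
    rfl

end ObjectiveStructure

theorem exists_norm_apply_le {W W' : Type*} [NormedAddCommGroup W] [NormedSpace ℝ W]
    [FiniteDimensional ℝ W] [NormedAddCommGroup W'] [NormedSpace ℝ W'] (S : W →ₗ[ℝ] W') :
    ∃ C : ℝ, 0 ≤ C ∧ ∀ x, ‖S x‖ ≤ C * ‖x‖ :=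
  ⟨_, norm_nonneg _, (LinearMap.toContinuousLinearMap S).le_opNorm⟩

namespace ObjectiveStructure

variable {d₁ d₂ : ℕ} (X : ObjectiveStructure d₁ d₂)

/-! ### Finitely supported functions -/

/-- A finitely supported function has a periodization with the same energies. -/
theorem exists_periodization (s K : Finset X.grp) (w : X.grp → Space d₁ d₂)
    (hw : ∀ g, g ∉ K → w g = 0 ∧ twistedDiff X.rotHom s w g = 0) :
    ∃ N ∈ normalExponents X.T, ∃ u : X.Uper, X.IsPeriodicWith N (X.fn u) ∧
      ∀ φ : (s → Space d₁ d₂) → ℝ, φ 0 = 0 →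
        (X.average N fun g => φ (twistedDiff X.rotHom s (X.fn u) g)) =
          (Nat.card (X.grp ⧸ X.lattice N) : ℝ)⁻¹ *
            ∑ g ∈ K, φ (twistedDiff X.rotHom s w g) := by
  classical
  -- A difference at `g` reads the values at `g` and at `gh`, `h ∈ s`. The lattice is then chosen to
  -- avoid all quotients through which two copies of `K` could interact.
  let E : Finset X.grp := insert 1 s
  let K₂ : Finset X.grp := enlarge E K
  obtain ⟨N, hN, hsparse⟩ := X.exists_sparse_lattice
    (((K₂ ×ˢ K₂).image fun p => p.1⁻¹ * p.2) ∪
      (K₂ ×ˢ E ×ˢ K).image fun p => (p.1 * p.2.1)⁻¹ * p.2.2 : Finset X.grp) (Finset.finite_toSet _)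
  have h1 : ∀ a ∈ K₂, ∀ b ∈ K₂, a⁻¹ * b ∈ X.lattice N → a = b := fun a ha b hb hab => by
    refine inv_mul_eq_one.1 (hsparse _ ?_ hab)
    exact Finset.mem_union_left _ (Finset.mem_image.2 ⟨(a, b), Finset.mk_mem_product ha hb, rfl⟩)
  have h2 : ∀ a ∈ K₂, ∀ h ∈ E, ∀ k ∈ K, (a * h)⁻¹ * k ∈ X.lattice N → a * h = k :=
    fun a ha h hh k hk hab => by
      refine inv_mul_eq_one.1 (hsparse _ ?_ hab)
      exact Finset.mem_union_right _ (Finset.mem_image.2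
        ⟨(a, h, k), Finset.mk_mem_product ha (Finset.mk_mem_product hh hk), rfl⟩)
  have hnormal := lattice_normal hN
  have hfinite := lattice_finite hN
  have hper := rightInvariant_periodize (X.lattice N) K w
  let u : X.Uper := ⟨boundedMk (periodize (X.lattice N) K w) (∑ k ∈ K, ‖w k‖) fun g =>
    (norm_sum_le _ _).trans (Finset.sum_le_sum fun k _ => by
      split_ifs
      · exact le_rfl
      · rw [norm_zero]; exact norm_nonneg _), N, hN, (isPeriodicWith_iff hN).2 hper⟩
  refine ⟨N, hN, u, (isPeriodicWith_iff hN).2 hper, fun φ hφ => ?_⟩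
  have hsum : ∑ g ∈ K, φ (twistedDiff X.rotHom s w g) =
      ∑ g ∈ K₂, φ (twistedDiff X.rotHom s w g) :=
    Finset.sum_subset (fun g hg => mem_enlarge.2 (Or.inl hg)) fun g _ hg => by
      rw [(hw g hg).2, hφ]
  have hloc : ∀ (v : X.grp → Space d₁ d₂) (g : X.grp),
      twistedDiff X.rotHom s v g = twistedDiff X.rotHom s (fun h => v (g * h)) 1 := fun v g => by
    funext h
    simp only [twistedDiff, one_mul, mul_one]
  rw [hsum, average_eq]
  simp only [hloc w, hloc (X.fn u)]
  refine cosetAverage_periodize K K₂ E w (fun g hg => (hw g hg).1)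
    (fun g h hh hgh => mem_enlarge.2 (Or.inr ⟨h, hh, hgh⟩)) h1 h2
    (fun v => φ (twistedDiff X.rotHom s v 1)) (fun a b hab => ?_) ?_
  · congr 1
    funext h
    simp only [twistedDiff, one_mul]
    rw [hab 1 (Finset.mem_insert_self _ _), hab h (Finset.mem_insert_of_mem h.2)]
  · rw [← hφ]
    congr 1
    funext h
    simp only [twistedDiff, Pi.zero_apply, map_zero, sub_zero]

variable {X} in
theorem card_quotient_pos {N : ℕ} (hN : N ∈ normalExponents X.T) :
    (0 : ℝ) < (Nat.card (X.grp ⧸ X.lattice N) : ℝ)⁻¹ := by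
  have := lattice_finite hN
  have hne : Nonempty (X.grp ⧸ X.lattice N) := ⟨((1 : X.grp) : X.grp ⧸ X.lattice N)⟩
  have : 0 < Nat.card (X.grp ⧸ X.lattice N) := Nat.card_pos
  positivity

/-! ### Infinitesimal isometries -/

theorem rot_mul_apply (g h : X.grp) (x : Space d₁ d₂) : X.rot (g * h) x = X.rot g (X.rot h x) := rfl

/-- Conjugation of an infinitesimal rotation by `rot(g)`. -/
noncomputable def conj (g : X.grp) (S : Space d₁ d₂ →ₗ[ℝ] Space d₁ d₂) :
    Space d₁ d₂ →ₗ[ℝ] Space d₁ d₂ :=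
  (X.rot g).symm.toLinearEquiv.toLinearMap ∘ₗ S ∘ₗ (X.rot g).toLinearEquiv.toLinearMap

theorem conj_apply (g : X.grp) (S : Space d₁ d₂ →ₗ[ℝ] Space d₁ d₂) (x : Space d₁ d₂) :
    X.conj g S x = (X.rot g).symm (S (X.rot g x)) := rfl

/-- Orthogonality preserves skewness, and `rot(g)` is block diagonal, so it preserves the subspace
`0 × ℝ^{d₂}` on which `S` vanishes. -/
theorem conj_mem {S : Space d₁ d₂ →ₗ[ℝ] Space d₁ d₂} (hS : S ∈ skewZeroZero d₁ d₂) (g : X.grp) :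
    X.conj g S ∈ skewZeroZero d₁ d₂ := by
  refine ⟨fun x y => ?_, fun y => ?_⟩
  · rw [conj_apply, conj_apply, ← (X.rot g).inner_map_map, LinearIsometryEquiv.apply_symm_apply,
      hS.1, ← (X.rot g).inner_map_map x, LinearIsometryEquiv.apply_symm_apply]
  · have : X.rot g (WithLp.toLp 2 (0, y)) =
        WithLp.toLp 2 (0, (g : Orth d₁ × Euc d₂).2.linearIsometryEquiv y) := by
      change WithLp.toLp 2 ((g : Orth d₁ × Euc d₂).1 0, _) = _
      rw [map_zero]
      rfl
    rw [conj_apply, this, hS.2, map_zero]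

/-- The infinitesimal isometry with translation `a` and rotation `S`. -/
noncomputable def isoField (a : Space d₁ d₂) (S : Space d₁ d₂ →ₗ[ℝ] Space d₁ d₂) (g : X.grp) :
    Space d₁ d₂ :=
  (X.rot g).symm (a + S (X.act g X.x₀ - X.x₀))

theorem rot_isoField (a : Space d₁ d₂) (S : Space d₁ d₂ →ₗ[ℝ] Space d₁ d₂) (g : X.grp) :
    X.rot g (X.isoField a S g) = a + S (X.act g X.x₀ - X.x₀) :=
  LinearIsometryEquiv.apply_symm_apply _ _

/-- Seen from `g`, an infinitesimal isometry is again one: its translation is the value at `g`, its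
rotation is conjugated by `rot(g)`. -/
theorem isoField_mul (a : Space d₁ d₂) (S : Space d₁ d₂ →ₗ[ℝ] Space d₁ d₂) (g k : X.grp) :
    X.isoField a S (g * k) = X.isoField (X.isoField a S g) (X.conj g S) k := by
  apply (X.rot k).injective
  apply (X.rot g).injective
  rw [← rot_mul_apply, rot_isoField, rot_isoField, map_add, rot_isoField, conj_apply,
    LinearIsometryEquiv.apply_symm_apply, ← act_sub_act, ← act_mul, add_assoc, ← map_add]
  congr 2
  abel

theorem isoField_one (a : Space d₁ d₂) (S : Space d₁ d₂ →ₗ[ℝ] Space d₁ d₂) :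
    X.isoField a S 1 = a := by
  have := X.rot_isoField a S 1
  rw [act_one, sub_self, map_zero, add_zero] at this
  exact this

/-- Recentring at `g` removes the translation and leaves an infinitesimal rotation of the reference
differences, the direction in which the rotation identity for `Q` applies. -/
theorem twistedDiff_isoField (s : Finset X.grp) (a : Space d₁ d₂)
    (S : Space d₁ d₂ →ₗ[ℝ] Space d₁ d₂) (g : X.grp) :
    twistedDiff X.rotHom s (X.isoField a S) g =
      fun h : s => X.conj g S (X.act h X.x₀ - X.x₀) := by
  funext h
  change X.rot h (X.isoField a S (g * h)) - X.isoField a S g = _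
  rw [isoField_mul, rot_isoField, add_sub_cancel_left]

/-- Conjugation at `gh` is conjugation at `g` followed by conjugation with `rot(h)`, so the twist
turns the varying rotation into the fixed one at `g`. This rewrites `f(S_g Dv(g))` as `f` of a
difference of one global field. -/
theorem twistedDiff_conj (s : Finset X.grp) (S : Space d₁ d₂ →ₗ[ℝ] Space d₁ d₂)
    (v : X.grp → Space d₁ d₂) (g : X.grp) :
    twistedDiff X.rotHom s (fun g => X.conj g S (v g)) g =
      fun h : s => X.conj g S (twistedDiff X.rotHom s v g h) := by
  funext h
  change X.rot h (X.conj (g * h) S (v (g * h))) - X.conj g S (v g) =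
    X.conj g S (X.rot h (v (g * h)) - v g)
  rw [map_sub]
  congr 1
  apply (X.rot g).injective
  rw [← rot_mul_apply, conj_apply, conj_apply, LinearIsometryEquiv.apply_symm_apply,
    LinearIsometryEquiv.apply_symm_apply]
  rfl

/-- `S` sees only the first component of `g · x₀ - x₀`, and that of `g · x₀` stays on a sphere under
`O(d₁)`. Boundedness would fail for rotations acting on the `d₂` unbounded directions. -/
theorem norm_isoField_le {S : Space d₁ d₂ →ₗ[ℝ] Space d₁ d₂} (hS : S ∈ skewZeroZero d₁ d₂)
    (a : Space d₁ d₂) : ∃ M : ℝ, ∀ g, ‖X.isoField a S g‖ ≤ M := by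
  obtain ⟨C, hC, hCS⟩ := exists_norm_apply_le S
  refine ⟨‖a‖ + C * (‖X.x₀.fst‖ + ‖X.x₀.fst‖), fun g => ?_⟩
  rw [isoField, LinearIsometryEquiv.norm_map]
  refine (norm_add_le _ _).trans (add_le_add_right ?_ _)
  have h1 : ∀ x : Space d₁ d₂, ‖S x‖ ≤ C * ‖x.fst‖ := fun x => by
    have h2 : x = WithLp.toLp 2 (x.fst, 0) + WithLp.toLp 2 (0, x.snd) := by
      rw [← WithLp.toLp_add, Prod.mk_add_mk, add_zero, zero_add]
      rfl
    have h3 : S x = S (WithLp.toLp 2 (x.fst, 0)) := by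
      conv_lhs => rw [h2]
      rw [map_add, hS.2, add_zero]
    rw [h3]
    refine (hCS _).trans (le_of_eq ?_)
    simp
  refine (h1 _).trans (mul_le_mul_of_nonneg_left ?_ hC)
  have h5 : (X.act g X.x₀ - X.x₀).fst = (g : Orth d₁ × Euc d₂).1 X.x₀.fst - X.x₀.fst := rfl
  rw [h5]
  refine (norm_sub_le _ _).trans (le_of_eq ?_)
  rw [LinearIsometryEquiv.norm_map]

/-- The space of all infinitesimal isometries. -/
noncomputable def isoSpace : Submodule ℝ (X.grp → Space d₁ d₂) :=
  LinearMap.range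
    ({ toFun := fun p => X.isoField p.1 p.2
       map_add' := fun p q => by
        funext g
        change (X.rot g).symm (p.1 + q.1 +
            ((p.2 : Space d₁ d₂ →ₗ[ℝ] Space d₁ d₂) (X.act g X.x₀ - X.x₀) +
              (q.2 : Space d₁ d₂ →ₗ[ℝ] Space d₁ d₂) (X.act g X.x₀ - X.x₀))) =
          (X.rot g).symm _ + (X.rot g).symm _
        rw [← map_add]
        congr 1
        abel
       map_smul' := fun c p => by
        funext g
        change (X.rot g).symm (c • p.1 +
            c • (p.2 : Space d₁ d₂ →ₗ[ℝ] Space d₁ d₂) (X.act g X.x₀ - X.x₀)) =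
          c • (X.rot g).symm _
        rw [← smul_add, map_smul] } :
      (Space d₁ d₂ × skewZeroZero d₁ d₂) →ₗ[ℝ] (X.grp → Space d₁ d₂))

variable {X} in
theorem mem_isoSpace {e : X.grp → Space d₁ d₂} :
    e ∈ X.isoSpace ↔ ∃ a, ∃ S ∈ skewZeroZero d₁ d₂, X.isoField a S = e := by
  constructor
  · rintro ⟨⟨a, S⟩, rfl⟩
    exact ⟨a, S, S.2, rfl⟩
  · rintro ⟨a, S, hS, rfl⟩
    exact ⟨⟨a, S, hS⟩, rfl⟩

instance finiteDimensional_isoSpace : FiniteDimensional ℝ X.isoSpace :=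
  LinearMap.finiteDimensional_range _

variable {X} in
theorem shift_mem_isoSpace {e : X.grp → Space d₁ d₂} (he : e ∈ X.isoSpace) (g : X.grp) :
    (fun k => e (g * k)) ∈ X.isoSpace := by
  obtain ⟨a, S, hS, rfl⟩ := mem_isoSpace.1 he
  exact mem_isoSpace.2 ⟨_, _, X.conj_mem hS g, funext fun k => (X.isoField_mul a S g k).symm⟩

variable {X} in
-- Vanishing at `1` kills the translation. Then `R · x₀` lies in the affine space `x₀ + ker S`,
-- hence so does the whole orbit. `S` itself need not vanish.
theorem eq_zero_of_mem_isoSpace {R : Set X.grp} (hR : X.HasPropertyOne R)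
    {e : X.grp → Space d₁ d₂} (he : e ∈ X.isoSpace) (h0 : ∀ h ∈ R, e h = 0) : e = 0 := by
  obtain ⟨a, S, hS, rfl⟩ := mem_isoSpace.1 he
  have ha : a = 0 := by rw [← X.isoField_one a S, h0 1 hR.2.1]
  subst ha
  have h1 : affineSpan ℝ ((fun g => X.act g X.x₀) '' R) ≤
      AffineSubspace.mk' X.x₀ (LinearMap.ker S) := by
    rw [affineSpan_le]
    rintro _ ⟨h, hh, rfl⟩
    have h2 := X.rot_isoField 0 S h
    rw [h0 h hh, map_zero, zero_add] at h2
    exact h2.symm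
  rw [hR.2.2] at h1
  funext g
  have h3 : X.act g X.x₀ -ᵥ X.x₀ ∈ LinearMap.ker S :=
    (AffineSubspace.mem_mk' ..).1 (h1 (subset_affineSpan ℝ _ ⟨g, rfl⟩))
  have h4 : S (X.act g X.x₀ - X.x₀) = 0 := h3
  rw [isoField, h4, add_zero, map_zero]
  rfl

/-- Coordinates on the space of infinitesimal isometries, which are controlled by the values on each
translate of a set with the same affine hull as the orbit. -/
theorem exists_coordinates {R : Finset X.grp} (hR : X.HasPropertyOne R) :
    ∃ (m : ℕ) (e : Fin m → X.grp → Space d₁ d₂) (c : X.isoSpace →ₗ[ℝ] (Fin m → ℝ)) (M C : ℝ),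
      (∀ i, e i ∈ X.isoSpace) ∧ (∀ i g, ‖e i g‖ ≤ M) ∧ 0 ≤ C ∧
      (∀ (x : X.isoSpace) (g : X.grp), (x : X.grp → Space d₁ d₂) g = ∑ i, c x i • e i g) ∧
      ∀ (x : X.isoSpace) (g : X.grp) (δ : ℝ),
        (∀ h ∈ R, ‖(x : X.grp → Space d₁ d₂) (g * h)‖ ≤ δ) → ∀ i, |c x i| ≤ C * δ := by
  let b := Module.finBasis ℝ X.isoSpace
  let c : X.isoSpace →ₗ[ℝ] (Fin (Module.finrank ℝ X.isoSpace) → ℝ) := b.equivFun.toLinearMap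
  have hsum : ∀ (x : X.isoSpace) (g : X.grp), (x : X.grp → Space d₁ d₂) g =
      ∑ i, c x i • (b i : X.grp → Space d₁ d₂) g := fun x g => by
    conv_lhs => rw [← b.sum_equivFun x]
    simp only [Submodule.coe_sum, Submodule.coe_smul, Finset.sum_apply, Pi.smul_apply]
    rfl
  have hbound : ∀ i, ∃ M : ℝ, ∀ g, ‖(b i : X.grp → Space d₁ d₂) g‖ ≤ M := fun i => by
    obtain ⟨a, S, hS, h⟩ := mem_isoSpace.1 (b i).2
    rw [← h]
    exact X.norm_isoField_le hS a
  choose M hM using hbound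
  have hM' : ∀ i g, ‖(b i : X.grp → Space d₁ d₂) g‖ ≤ ∑ i, |M i| := fun i g =>
    ((hM i g).trans (le_abs_self _)).trans
      (Finset.single_le_sum (f := fun i => |M i|) (fun i _ => abs_nonneg _) (Finset.mem_univ i))
  let ev : X.isoSpace →ₗ[ℝ] (R → Space d₁ d₂) :=
    (LinearMap.funLeft ℝ (Space d₁ d₂) (Subtype.val : R → X.grp)) ∘ₗ X.isoSpace.subtype
  have hev : LinearMap.ker ev = ⊥ := by
    rw [LinearMap.ker_eq_bot']
    intro x hx
    apply Subtype.ext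
    exact eq_zero_of_mem_isoSpace hR x.2 fun h hh => congrFun hx ⟨h, hh⟩
  -- An infinitesimal isometry is determined by its values on `R`, so a linear left inverse recovers
  -- the coordinates from them.
  obtain ⟨l, hl⟩ := ev.exists_leftInverse_of_injective hev
  let L := LinearMap.toContinuousLinearMap (c ∘ₗ l)
  have hL : ∀ x, L (ev x) = c x := fun x =>
    congrArg c (LinearMap.congr_fun hl x)
  have h1 : ∀ (x : X.isoSpace) (δ : ℝ), 0 ≤ δ →
      (∀ h ∈ R, ‖(x : X.grp → Space d₁ d₂) h‖ ≤ δ) → ∀ i, |c x i| ≤ ‖L‖ * δ := by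
    intro x δ hδ h i
    have h2 : ‖ev x‖ ≤ δ := (pi_norm_le_iff_of_nonneg hδ).2 fun k => h k k.2
    have h3 := (norm_le_pi_norm (c x) i).trans ((hL x) ▸ L.le_opNorm (ev x))
    exact h3.trans (mul_le_mul_of_nonneg_left h2 (norm_nonneg _))
  refine ⟨_, fun i => b i, c, ∑ i, |M i|,
    ‖L‖ * (Module.finrank ℝ X.isoSpace * (‖L‖ * ∑ i, |M i|)), fun i => (b i).2, hM', ?_, hsum, ?_⟩
  · have : 0 ≤ ∑ i, |M i| := Finset.sum_nonneg fun i _ => abs_nonneg _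
    positivity
  · intro x g δ hx i
    have hδ : 0 ≤ δ := (norm_nonneg _).trans (hx 1 hR.2.1)
    -- Small values on `gR` bound the coordinates of the shift `x'`, hence `x'` everywhere since the
    -- basis is bounded, hence `x` on `R`. The constant does not depend on `g`.
    let x' : X.isoSpace := ⟨_, shift_mem_isoSpace x.2 g⟩
    have h2 := h1 x' δ hδ hx
    have h3 : ∀ k, ‖(x' : X.grp → Space d₁ d₂) k‖ ≤
        Module.finrank ℝ X.isoSpace * (‖L‖ * ∑ i, |M i|) * δ := fun k => by
      rw [hsum x' k]
      refine (norm_sum_le _ _).trans ((Finset.sum_le_sum (g := fun _ => ‖L‖ * δ * ∑ i, |M i|)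
        fun j _ => ?_).trans (le_of_eq ?_))
      · rw [norm_smul]
        exact mul_le_mul (h2 j) (hM' j k) (norm_nonneg _) (by positivity)
      · simp only [Finset.sum_const, Finset.card_univ, Fintype.card_fin, nsmul_eq_mul]
        ring
    have h4 := h1 x _ ((norm_nonneg _).trans (h3 1)) (fun h _ => by
      have := h3 (g⁻¹ * h)
      simpa [x'] using this) i
    exact h4.trans (le_of_eq (by ring))

end ObjectiveStructure

/-! ### Local approximation with slowly varying coefficients -/

/-- If the increments of `p` along a generating set are controlled by `n`, then so are the increments
along any group element. -/
theorem exists_increment_bound {G : Type*} [Group G] {R : Set G} (hR : Subgroup.closure R = ⊤)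
    (h : G) : ∃ (E : Finset G) (D : ℝ), 0 ≤ D ∧ ∀ p n : G → ℝ, (∀ g, 0 ≤ n g) →
      (∀ g, ∀ k ∈ R, |p (g * k) - p g| ≤ n (g * k) + n g) →
      ∀ g, |p (g * h) - p g| ≤ D * ∑ e ∈ E, n (g * e) := by
  classical
  have hmem : h ∈ Subgroup.closure R := hR ▸ Subgroup.mem_top h
  induction hmem using Subgroup.closure_induction with
  | mem k hk =>
    refine ⟨{1, k}, 2, zero_le_two, fun p n hn hp g => (hp g k hk).trans ?_⟩
    have h1 := Finset.single_le_sum (f := fun e => n (g * e)) (s := {1, k}) (fun e _ => hn _)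
      (show 1 ∈ ({1, k} : Finset G) by simp)
    have h2 := Finset.single_le_sum (f := fun e => n (g * e)) (s := {1, k}) (fun e _ => hn _)
      (show k ∈ ({1, k} : Finset G) by simp)
    simp only [mul_one] at h1
    linarith
  | one => exact ⟨∅, 0, le_rfl, fun p n _ _ g => by simp⟩
  | mul h k _ _ ihh ihk =>
    obtain ⟨E, D, hD, hE⟩ := ihh
    obtain ⟨E', D', hD', hE'⟩ := ihk
    refine ⟨E ∪ E'.image (h * ·), D + D', add_nonneg hD hD', fun p n hn hp g => ?_⟩
    have h1 := hE p n hn hp g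
    have h2 := hE' p n hn hp (g * h)
    have h3 : ∑ e ∈ E, n (g * e) ≤ ∑ e ∈ E ∪ E'.image (h * ·), n (g * e) :=
      Finset.sum_le_sum_of_subset_of_nonneg Finset.subset_union_left fun _ _ _ => hn _
    have h4 : ∑ e ∈ E', n (g * h * e) ≤ ∑ e ∈ E ∪ E'.image (h * ·), n (g * e) := by
      refine le_trans (le_of_eq ?_) (Finset.sum_le_sum_of_subset_of_nonneg
        Finset.subset_union_right fun _ _ _ => hn _)
      rw [Finset.sum_image fun _ _ _ _ => mul_left_cancel]
      simp only [mul_assoc]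
    have h5 : |p (g * (h * k)) - p g| ≤ |p (g * h * k) - p (g * h)| + |p (g * h) - p g| := by
      rw [← mul_assoc]
      exact abs_sub_le _ _ _
    have h6 := mul_le_mul_of_nonneg_left h3 hD
    have h7 := mul_le_mul_of_nonneg_left h4 hD'
    rw [add_mul]
    linarith
  | inv h _ ih =>
    obtain ⟨E, D, hD, hE⟩ := ih
    refine ⟨E.image (h⁻¹ * ·), D, hD, fun p n hn hp g => ?_⟩
    have h1 := hE p n hn hp (g * h⁻¹)
    rw [inv_mul_cancel_right, abs_sub_comm] at h1
    rw [Finset.sum_image fun _ _ _ _ => mul_left_cancel]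
    simpa only [mul_assoc] using h1

theorem exists_increment_bound_uniform {G : Type*} [Group G] {R : Set G}
    (hR : Subgroup.closure R = ⊤) (s : Finset G) :
    ∃ (E : Finset G) (D : ℝ), 0 ≤ D ∧ 1 ∈ E ∧ s ⊆ E ∧ ∀ p n : G → ℝ, (∀ g, 0 ≤ n g) →
      (∀ g, ∀ k ∈ R, |p (g * k) - p g| ≤ n (g * k) + n g) →
      ∀ g, ∀ h ∈ s, |p (g * h) - p g| ≤ D * ∑ e ∈ E, n (g * e) := by
  classical
  choose E D hD hE using exists_increment_bound hR
  -- Including 1 and `s` lets the same sum also dominate `n g` and `n (g * h)`.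
  refine ⟨insert 1 (s ∪ s.biUnion E), ∑ h ∈ s, D h, Finset.sum_nonneg fun h _ => hD h,
    Finset.mem_insert_self _ _, fun h hh => Finset.mem_insert_of_mem (Finset.mem_union_left _ hh),
    fun p n hn hp g h hh => (hE h p n hn hp g).trans ?_⟩
  refine mul_le_mul (Finset.single_le_sum (f := D) (fun h _ => hD h) hh)
    (Finset.sum_le_sum_of_subset_of_nonneg (fun e he => ?_) fun _ _ _ => hn _)
    (Finset.sum_nonneg fun _ _ => hn _) (Finset.sum_nonneg fun h _ => hD h)
  exact Finset.mem_insert_of_mem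
    (Finset.mem_union_right _ (Finset.mem_biUnion.2 ⟨h, hh, he⟩))

namespace ObjectiveStructure

variable {d₁ d₂ : ℕ} (X : ObjectiveStructure d₁ d₂)

/-- The distance of `u(g ·)|_R` to the infinitesimal isometries. -/
noncomputable def localDefect (R : Finset X.grp) (u : X.grp → Space d₁ d₂) (g : X.grp) : ℝ :=
  ‖(Submodule.orthogonal (X.UisoZeroZero R)).starProjection
    (WithLp.toLp 2 fun h : R => u (g * h))‖

theorem localDefect_nonneg (R : Finset X.grp) (u : X.grp → Space d₁ d₂) (g : X.grp) :
    0 ≤ X.localDefect R u g := norm_nonneg _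

theorem rightInvariant_localDefect {H : Subgroup X.grp} [H.Normal] (R : Finset X.grp)
    {u : X.grp → Space d₁ d₂} (hu : RightInvariant H u) :
    RightInvariant H (X.localDefect R u) := by
  intro g t ht
  have h : ∀ h, u (g * t * h) = u (g * h) := fun h => hu.shift h g t ht
  simp only [localDefect, h]

theorem exists_localDefect_le (R : Finset X.grp) (u : X.Uper) :
    ∃ L : ℝ, ∀ g, X.localDefect R (X.fn u) g ≤ L := by
  refine ⟨√(∑ _h : R, ‖u‖ ^ 2), fun g => ?_⟩
  refine ((Submodule.orthogonal (X.UisoZeroZero R)).norm_starProjection_apply_le _).trans ?_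
  rw [PiLp.norm_eq_of_L2]
  refine Real.sqrt_le_sqrt (Finset.sum_le_sum fun h _ => ?_)
  exact pow_le_pow_left₀ (norm_nonneg _) (X.norm_fn_le u _) 2

theorem exists_isoField_of_mem {R : Finset X.grp} {w : X.LocalFun R} (hw : w ∈ X.UisoZeroZero R) :
    ∃ e ∈ X.isoSpace, ∀ h : R, w h = e h := by
  obtain ⟨x, ⟨a, ha⟩, y, ⟨S, hS, hy⟩, rfl⟩ := Submodule.mem_sup.1 hw
  refine ⟨_, mem_isoSpace.2 ⟨a, S, hS, rfl⟩, fun h => (X.rot h).injective ?_⟩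
  rw [rot_isoField, PiLp.add_apply, map_add, ha, hy]

/-- On each translate of `R`, a function is close to an infinitesimal isometry. -/
theorem exists_local_approximation (R : Finset X.grp) (u : X.grp → Space d₁ d₂) (g : X.grp) :
    ∃ x : X.isoSpace, ∀ h ∈ R,
      ‖u (g * h) - (x : X.grp → Space d₁ d₂) (g * h)‖ ≤ X.localDefect R u g := by
  set w : X.LocalFun R := WithLp.toLp 2 fun h : R => u (g * h) with hw
  -- The orthogonal projection of `u(g ·)|_R` extends to an infinitesimal isometry on the whole
  -- group, which is then shifted back by `g⁻¹`.
  obtain ⟨e, he, hew⟩ := X.exists_isoField_of_mem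
    ((X.UisoZeroZero R).starProjection_apply_mem w)
  refine ⟨⟨_, shift_mem_isoSpace he g⁻¹⟩, fun h hh => ?_⟩
  have h1 := PiLp.norm_apply_le (Submodule.starProjection (X.UisoZeroZero R)ᗮ w) ⟨h, hh⟩
  rw [Submodule.starProjection_orthogonal_val] at h1
  change ‖w ⟨h, hh⟩ - (X.UisoZeroZero R).starProjection w ⟨h, hh⟩‖ ≤ _ at h1
  rw [hew] at h1
  change ‖u (g * h) - e (g⁻¹ * (g * h))‖ ≤ _
  rw [localDefect, inv_mul_cancel_left, Submodule.starProjection_orthogonal_val]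
  exact h1

/-- A function is approximated by a combination of finitely many infinitesimal isometries with slowly
varying coefficients. -/
theorem exists_slow_coefficients {R : Finset X.grp} (hR : X.HasPropertyTwo R) (s : Finset X.grp) :
    ∃ (m : ℕ) (e : Fin m → X.grp → Space d₁ d₂) (M B : ℝ) (E : Finset X.grp),
      (∀ i, e i ∈ X.isoSpace) ∧ (∀ i g, ‖e i g‖ ≤ M) ∧ 0 ≤ B ∧
      ∀ u : X.Uper, ∃ (p : Fin m → X.grp → ℝ) (L : ℝ),
        (∀ g, ‖X.fn u g - ∑ i, p i g • e i g‖ ≤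
          B * ∑ k ∈ E, X.localDefect R (X.fn u) (g * k)) ∧
        (∀ g, ∀ h ∈ s, ‖X.fn u (g * h) - ∑ i, p i (g * h) • e i (g * h)‖ ≤
          B * ∑ k ∈ E, X.localDefect R (X.fn u) (g * k)) ∧
        (∀ i g, ∀ h ∈ s, |p i (g * h) - p i g| ≤
          B * ∑ k ∈ E, X.localDefect R (X.fn u) (g * k)) ∧
        (∀ g, ‖X.fn u g‖ ≤ L) ∧ ∀ i g, |p i g| ≤ L := by
  obtain ⟨-, R', R₂, h1R', hgen, hR₂, hsub⟩ := hR
  obtain ⟨R₂, rfl⟩ := hR₂.1.exists_finset_coe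
  obtain ⟨m, e, c, M, C, he, hM, hC, hc, hcC⟩ := X.exists_coordinates hR₂
  obtain ⟨E, D, hD, h1E, hsE, hED⟩ := exists_increment_bound_uniform hgen s
  refine ⟨m, e, M, 1 + D * C, E, he, hM, by positivity, fun u => ?_⟩
  set n := X.localDefect R (X.fn u) with hn
  have hn0 : ∀ g, 0 ≤ n g := X.localDefect_nonneg R _
  choose x hx using X.exists_local_approximation R (X.fn u)
  obtain ⟨L, hL⟩ := X.exists_localDefect_le R u
  have hmemR : ∀ k ∈ R', ∀ h ∈ R₂, k * h ∈ R := fun k hk h hh =>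
    hsub (Set.mul_mem_mul hk hh)
  have hsumE : ∀ g, 0 ≤ ∑ k ∈ E, n (g * k) := fun g => Finset.sum_nonneg fun _ _ => hn0 _
  have hle : ∀ g, ∑ k ∈ E, n (g * k) ≤ (1 + D * C) * ∑ k ∈ E, n (g * k) := fun g => by
    have := mul_nonneg (mul_nonneg hD hC) (hsumE g)
    linarith
  have happrox : ∀ g, ‖X.fn u g - ∑ i, c (x g) i • e i g‖ ≤ n g := fun g => by
    rw [← hc]
    have := hx g 1 (by simpa using hmemR 1 h1R' 1 hR₂.2.1)
    rwa [mul_one] at this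
  have hEle : ∀ g, ∀ k ∈ E, n (g * k) ≤ ∑ k ∈ E, n (g * k) := fun g k hk =>
    Finset.single_le_sum (f := fun k => n (g * k)) (fun _ _ => hn0 _) hk
  refine ⟨fun i g => c (x g) i, max ‖u‖ (C * (‖u‖ + L)), fun g => ?_, fun g h hh => ?_,
    fun i g h hh => ?_, fun g => (X.norm_fn_le u g).trans (le_max_left _ _), fun i g => ?_⟩
  · have := hEle g 1 h1E
    rw [mul_one] at this
    exact (happrox g).trans (this.trans (hle g))
  · exact (happrox (g * h)).trans ((hEle g h (hsE hh)).trans (hle g))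
  · have hinc : ∀ g, ∀ k ∈ R', |c (x (g * k)) i - c (x g) i| ≤ C * n (g * k) + C * n g := by
      intro g k hk
      rw [← Pi.sub_apply, ← map_sub, ← mul_add]
      refine hcC (x (g * k) - x g) (g * k) _ (fun h hh => ?_) i
      have h1 := hx (g * k) h (by simpa using hmemR 1 h1R' h hh)
      have h2 := hx g (k * h) (hmemR k hk h hh)
      rw [← mul_assoc] at h2
      rw [Submodule.coe_sub, Pi.sub_apply]
      have h3 := norm_sub_le_norm_sub_add_norm_sub
        ((x (g * k) : X.grp → Space d₁ d₂) (g * k * h)) (X.fn u (g * k * h))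
        ((x g : X.grp → Space d₁ d₂) (g * k * h))
      rw [norm_sub_rev _ (X.fn u (g * k * h))] at h3
      linarith
    have h1 := hED (fun g => c (x g) i) (fun g => C * n g) (fun g => mul_nonneg hC (hn0 g)) hinc g h hh
    refine h1.trans ?_
    rw [← Finset.mul_sum, ← mul_assoc]
    have := hsumE g
    linarith
  · refine (hcC (x g) g (‖u‖ + L) (fun h hh => ?_) i).trans (le_max_right _ _)
    have h1 := hx g h (by simpa using hmemR 1 h1R' h hh)
    have h2 := norm_le_norm_add_norm_sub (X.fn u (g * h)) ((x g : X.grp → Space d₁ d₂) (g * h))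
    linarith [X.norm_fn_le u (g * h), hL g]

theorem seminormZeroZero_sq (R : Finset X.grp) (u : X.Uper) :
    X.seminormZeroZero R u ^ 2 =
      cosetAverage (X.lattice (X.period u)) fun g => X.localDefect R (X.fn u) g ^ 2 := by
  have hN := period_mem u
  refine Real.sq_sqrt ?_
  change 0 ≤ cosetAverage (X.lattice (X.period u)) fun g => X.localDefect R (X.fn u) g ^ 2
  exact mul_nonneg (by positivity) (finsum_nonneg fun c => by positivity)

end ObjectiveStructure

/-! ### Passage to averages and the bound on the second variation -/

/-- If the energy on Følner sets is controlled up to a boundary term, then so is its average. -/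
theorem cosetAverage_le_of_sum_le {G : Type*} [Group G] [DecidableEq G] (H : Subgroup G) [H.Normal]
    [Finite (G ⧸ H)] (hcomm : ∀ a ∈ H, ∀ b ∈ H, a * b = b * a) (s : Finset G) {f f' : G → ℝ}
    (hf : RightInvariant H f) (hf' : RightInvariant H f') {C L : ℝ} (hC : 0 ≤ C) (hL : 0 ≤ L)
    (h : ∀ F : Finset G, ∑ g ∈ F, f g ≤ C * (∑ g ∈ F, f' g + (boundary s F).card * L)) :
    cosetAverage H f ≤ C * cosetAverage H f' := by
  refine le_of_forall_pos_le_add fun δ hδ => ?_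
  obtain ⟨ε, hε, hεδ⟩ : ∃ ε > 0, C * ((s.card * ε + s.card * ε) * L) ≤ δ := by
    -- The summand 1 keeps the denominator positive.
    refine ⟨δ / (2 * s.card * C * L + 1), by positivity, ?_⟩
    rw [show C * ((s.card * (δ / (2 * s.card * C * L + 1)) +
      s.card * (δ / (2 * s.card * C * L + 1))) * L) =
      δ * (2 * s.card * C * L / (2 * s.card * C * L + 1)) by ring]
    refine mul_le_of_le_one_right hδ.le (div_le_one_of_le₀ (by linarith) (by positivity))
  obtain ⟨F, hF, hsum, hbd⟩ := exists_folner H hcomm (s ∪ s.image (·⁻¹)) hε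
  have hFpos : (0 : ℝ) < F.card := by exact_mod_cast hF.card_pos
  have h1 := h F
  rw [hsum f hf, hsum f' hf'] at h1
  have h2 : ((boundary s F).card : ℝ) ≤ s.card * (ε * F.card) + s.card * (ε * F.card) := by
    have h3 : ((boundary s F).card : ℝ) ≤ ∑ h ∈ s, ((F.filter fun g => g * h ∉ F).card : ℝ) +
        ∑ h ∈ s, ((F.filter fun g => g * h⁻¹ ∉ F).card : ℝ) := by
      exact_mod_cast card_boundary_le s F
    refine h3.trans (add_le_add ?_ ?_)
    · rw [← nsmul_eq_mul]
      exact Finset.sum_le_card_nsmul _ _ _ fun h hh => hbd h (Finset.mem_union_left _ hh)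
    · rw [← nsmul_eq_mul]
      exact Finset.sum_le_card_nsmul _ _ _ fun h hh =>
        hbd h⁻¹ (Finset.mem_union_right _ (Finset.mem_image_of_mem _ hh))
  have h4 := mul_le_mul_of_nonneg_left (mul_le_mul_of_nonneg_right h2 hL) hC
  have h5 := mul_le_mul_of_nonneg_left hεδ hFpos.le
  refine le_of_mul_le_mul_left ?_ hFpos
  rw [mul_add]
  nlinarith

namespace ObjectiveStructure

variable {d₁ d₂ : ℕ} (X : ObjectiveStructure d₁ d₂)

/-- If a nonnegative second variation annihilates the infinitesimal isometries, it is controlled by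
the seminorm. -/
theorem exists_average_le {R : Finset X.grp} (hR : X.HasPropertyTwo R) {s : Finset X.grp}
    {Q : (s → Space d₁ d₂) →L[ℝ] (s → Space d₁ d₂) →L[ℝ] ℝ} (hsym : ∀ a b, Q a b = Q b a)
    (hpos : ∀ (K : Finset X.grp) (v : X.grp → Space d₁ d₂),
      (∀ g, g ∉ K → v g = 0 ∧ twistedDiff X.rotHom s v g = 0) → 0 ≤ sumEnergy X.rotHom s Q K v)
    (hker : ∀ e ∈ X.isoSpace, ∀ (K : Finset X.grp) (v : X.grp → Space d₁ d₂),
      (∀ g, g ∉ K → v g = 0 ∧ twistedDiff X.rotHom s v g = 0) →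
      ∑ g ∈ K, Q (twistedDiff X.rotHom s e g) (twistedDiff X.rotHom s v g) = 0) :
    ∃ C : ℝ, 0 ≤ C ∧ ∀ u : X.Uper, X.average (X.period u) (fun g =>
      Q (twistedDiff X.rotHom s (X.fn u) g) (twistedDiff X.rotHom s (X.fn u) g)) ≤
        C * X.seminormZeroZero R u ^ 2 := by
  classical
  obtain ⟨m, e, M, B, E, he, hM, hB, hu⟩ := X.exists_slow_coefficients hR s
  obtain ⟨C, hC, hCF⟩ := exists_sumEnergy_le hsym hpos e hM fun i => hker (e i) (he i)
  refine ⟨C * (B ^ 2 * (E.card : ℝ) ^ 2), by positivity, fun u => ?_⟩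
  obtain ⟨p, L, h1, h2, h3, h4, h5⟩ := hu u
  have hN := period_mem u
  have := lattice_normal hN
  have := lattice_finite hN
  have hper := isPeriodicWith_period u
  have hinv := X.rightInvariant_localDefect R ((isPeriodicWith_iff hN).1 hper)
  have hQinv : RightInvariant (X.lattice (X.period u)) fun g =>
      Q (twistedDiff X.rotHom s (X.fn u) g) (twistedDiff X.rotHom s (X.fn u) g) := fun g t ht => by
    have := (isPeriodicWith_iff hN).1 (hper.twistedDiff hN s) g t ht
    simp only [this]
  have hninv : RightInvariant (X.lattice (X.period u)) fun g =>
      (B * ∑ k ∈ E, X.localDefect R (X.fn u) (g * k)) ^ 2 := fun g t ht => by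
    have : ∀ k, X.localDefect R (X.fn u) (g * t * k) = X.localDefect R (X.fn u) (g * k) :=
      fun k => hinv.shift k g t ht
    simp only [this]
  -- The bound `L` depends on `u` but enters only through the boundary term, which disappears in the
  -- Følner limit. The constant is uniform in `u`.
  have hkey := cosetAverage_le_of_sum_le (X.lattice (X.period u)) (lattice_comm hN) s hQinv hninv hC
    (sq_nonneg L) fun F => hCF F (X.fn u) p _ L h1 h2 h3 h4 h5
  rw [average_eq, seminormZeroZero_sq, mul_assoc]
  exact hkey.trans (mul_le_mul_of_nonneg_left (cosetAverage_sq_sum_shift_le _ hinv B E) hC)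

/-- At a critical point, the infinitesimal isometries belong to the kernel of the second
variation. -/
theorem sum_twistedDiff_isoField_eq_zero {s : Finset X.grp} {f : (s → Space d₁ d₂) →L[ℝ] ℝ}
    {Q : (s → Space d₁ d₂) →L[ℝ] (s → Space d₁ d₂) →L[ℝ] ℝ}
    (hskew : ∀ S ∈ skewZeroZero d₁ d₂, ∀ z : s → Space d₁ d₂,
      Q (fun h => S (X.act h X.x₀ - X.x₀)) z = -f fun h => S (z h))
    (hf : ∀ (K : Finset X.grp) (v : X.grp → Space d₁ d₂),
      (∀ g, g ∉ K → v g = 0 ∧ twistedDiff X.rotHom s v g = 0) →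
      ∑ g ∈ K, f (twistedDiff X.rotHom s v g) = 0)
    {e : X.grp → Space d₁ d₂} (he : e ∈ X.isoSpace) (K : Finset X.grp)
    (v : X.grp → Space d₁ d₂) (hv : ∀ g, g ∉ K → v g = 0 ∧ twistedDiff X.rotHom s v g = 0) :
    ∑ g ∈ K, Q (twistedDiff X.rotHom s e g) (twistedDiff X.rotHom s v g) = 0 := by
  obtain ⟨a, S, hS, rfl⟩ := mem_isoSpace.1 he
  have h1 : ∀ g, Q (twistedDiff X.rotHom s (X.isoField a S) g) (twistedDiff X.rotHom s v g) =
      -f (twistedDiff X.rotHom s (fun g => X.conj g S (v g)) g) := fun g => by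
    rw [twistedDiff_isoField, twistedDiff_conj, hskew _ (X.conj_mem hS g)]
  rw [Finset.sum_congr rfl fun g _ => h1 g, Finset.sum_neg_distrib, neg_eq_zero]
  -- The conjugated field `S_g v(g)` vanishes, together with its differences, wherever `v` does, so
  -- criticality applies to it.
  refine hf K _ fun g hg => ⟨?_, ?_⟩
  · rw [(hv g hg).1, map_zero]
  · rw [twistedDiff_conj, (hv g hg).2]
    funext h
    exact map_zero _

end ObjectiveStructure

set_option maxHeartbeats 2000000 in
theorem mainTheorem6 {d₁ d₂ : ℕ} (hd₁ : 2 ≤ d₁) (X : ObjectiveStructure d₁ d₂)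
    (V : ({g : X.grp // g ≠ 1} → Space d₁ d₂) → ℝ) (hV : X.IsInteractionPotential V)
    (R : Finset X.grp) (hR : X.HasPropertyTwo R)
    (hcrit : X.energyDeriv V = 0)
    (hpsd : ∀ u : X.Uper, 0 ≤ X.energyHess V u u) :
    ContDiff ℝ 2 (X.energy V) ∧
      ∃ C : ℝ, 0 < C ∧ ∀ u v : X.Uper,
        |X.energyHess V u v| ≤ C * X.seminormZeroZero R u * X.seminormZeroZero R v := by
  obtain ⟨hC2, s, f, Q, hderiv, hhess, hsym, hskew⟩ := X.exists_energy_expansion hV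
  have hpos : ∀ (K : Finset X.grp) (v : X.grp → Space d₁ d₂),
      (∀ g, g ∉ K → v g = 0 ∧ twistedDiff X.rotHom s v g = 0) →
      0 ≤ sumEnergy X.rotHom s Q K v := fun K v hv => by
    obtain ⟨N, hN, u, hu, hφ⟩ := X.exists_periodization s K v hv
    have h1 := hpsd u
    rw [hhess u u N hN hu hu, hφ (fun z => Q z z) (by simp)] at h1
    exact nonneg_of_mul_nonneg_right h1 (ObjectiveStructure.card_quotient_pos hN)
  have hf : ∀ (K : Finset X.grp) (v : X.grp → Space d₁ d₂),
      (∀ g, g ∉ K → v g = 0 ∧ twistedDiff X.rotHom s v g = 0) →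
      ∑ g ∈ K, f (twistedDiff X.rotHom s v g) = 0 := fun K v hv => by
    obtain ⟨N, hN, u, hu, hφ⟩ := X.exists_periodization s K v hv
    have h1 := hderiv u N hN hu
    rw [hcrit, hφ (fun z => f z) (map_zero f)] at h1
    exact (mul_eq_zero.1 h1.symm).resolve_left (ObjectiveStructure.card_quotient_pos hN).ne'
  obtain ⟨C, hC, hle⟩ := X.exists_average_le hR hsym hpos fun e he K v hv =>
    X.sum_twistedDiff_isoField_eq_zero hskew hf he K v hv
  -- `C + 1` replaces `C` so that the final constant is strictly positive.
  have hdiag : ∀ u : X.Uper, X.energyHess V u u ≤ (C + 1) * X.seminormZeroZero R u ^ 2 :=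
    fun u => by
      have hu := ObjectiveStructure.isPeriodicWith_period u
      rw [hhess u u _ (ObjectiveStructure.period_mem u) hu hu]
      refine (hle u).trans (mul_le_mul_of_nonneg_right (by linarith) (sq_nonneg _))
  have hsymm : ∀ u v : X.Uper, X.energyHess V u v = X.energyHess V v u := fun u v => by
    have hu := ObjectiveStructure.isPeriodicWith_period u
    have hv := ObjectiveStructure.isPeriodicWith_period v
    obtain ⟨P, hP, h1, h2⟩ := X.exists_common_period (ObjectiveStructure.period_mem u)
      (ObjectiveStructure.period_mem v)
    rw [hhess u v P hP (h1 hu) (h2 hv), hhess v u P hP (h2 hv) (h1 hu)]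
    congr 1
    funext g
    exact hsym _ _
  refine ⟨hC2, C + 1, by positivity, fun u v => ?_⟩
  -- Cauchy–Schwarz for the symmetric positive semidefinite form `E''(x₀)` reduces the claim to the
  -- diagonal bound.
  have hcs : X.energyHess V u v ^ 2 ≤ X.energyHess V u u * X.energyHess V v v := by
    let b : LinearMap.BilinForm ℝ X.Uper := (X.energyHess V).toLinearMap₁₂
    have h1 := LinearMap.BilinForm.apply_sq_le_of_symm b hpsd ⟨fun x y => hsymm x y⟩ u v
    exact h1
  have hu0 : 0 ≤ X.seminormZeroZero R u := Real.sqrt_nonneg _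
  have hv0 : 0 ≤ X.seminormZeroZero R v := Real.sqrt_nonneg _
  refine abs_le_of_sq_le_sq (hcs.trans ?_) (by positivity)
  refine (mul_le_mul (hdiag u) (hdiag v) (hpsd v) (by positivity)).trans (le_of_eq ?_)
  ring
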